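/- **Setting.** There are $K\ge 2$ arms $a_1,\dots,a_K$, a time horizon $T$, and $M\ge1$ stationary segments $S_m=\{\nu_{m-1},\dots,\nu_m-1\}$, where $1=\nu_0<\nu_1<\dots<\nu_{M-1}<\nu_M=T+1$. In segment $S_m$ the preference matrix is $P^{(m)}=(p^{(m)}_{i,j})\in[0,1]^{K\times K}$ with $p^{(m)}_{i,j}+p^{(m)}_{j,i}=1$, and there is a Condorcet winner $a_{m^*}$, i.e. $p^{(m)}_{m^*,i}>\frac12$ for all $i\ne m^*$. A duel of the pair $(a_i,a_j)$ at a time $t\in S_m$ is won by $a_i$ with probability $p^{(m)}_{i,j}$, independently of everything else. With $\Delta^{(m)}_i:=p^{(m)}_{m^*,i}-\frac12$, the binary weak regret of playing $(a_{I_t},a_{J_t})$ at time $t\in S_m$ is $\lceil\min\{\Delta^{(m)}_{I_t},\Delta^{(m)}_{J_t}\}\rceil$, and $R^{\bar{\mathrm W}}(T)$ is its sum over $t=1,\dots,T$. **DETECT.** Let $Alg$ be any (possibly randomized) dueling bandits algorithm which chooses pairs on the basis of the duels observed since its initialization and can at any time name a suspected Condorcet winner. DETECT has parameters $\tilde T\in\mathbb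 N$, an even window length $w\ge2$, a threshold $b>0$ and, for each arm $a_i$, a fixed ordering of the other arms. It repeats the following cycle until time $T$: it runs a freshly initialized $Alg$ for $\tilde T$ steps and obtains its suspected Condorcet winner $a_I$; then it plays the pairs $(a_I,a_j)$, $j\neq I$, in round-robin fashion in the fixed ordering, until, for the pair just played, at least $w$ outcomes have been observed in the current detection phase and the numbers of wins of $a_I$ in the first and in the second half of the last $w$ of these outcomes differ in absolute value by more than $b$. At this step the changepoint detection is triggered and the cycle restarts in the next step. Let $L':=w(K-1)$ and $\delta^{(m)}_*:=\max_j|p^{(m+1)}_{m^*,j}-p^{(m)}_{m^*,j}|$ for $1\le m\le M-1$. Assume 1. $|S_m|\ge\tilde T+\frac32L'$ for all $m\in\{1,\dots,M\}$; 2. there is $c>0$ with $\delta_*^{(m)}\ge\frac{2b}{w}+c$ for all $m\in\{1,\dots,M-1\}$. Let $p_{\tilde T}$ be a real number such that, for every $m\le M$, the probability that $Alg$, run for $\tilde T$ steps in the stationary setting with preference matrix $P^{(m)}$, names $a_{m^*}$ as suspected Condorcet winner is at least $p_{\tilde T}$. For DETECT initialized at time $\nu_{m-1}$ let $\tau_m$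 be the time step at which the changepoint detection is triggered for the first time ($\tau_m=\infty$ if this does not happen up to time $T$), and let $a_{I_m}$ be the first suspected Condorcet winner returned by $Alg$. **Theorem.** Let $p,q\in[0,1]$ be such that $$\mathbb P(\tau_m<\nu_m\mid a_{I_m}=a_{m^*})\le p\quad\text{for all } m\le M,$$ $$\mathbb P(\tau_m\ge\nu_m+L'/2\mid\tau_m\ge\nu_m,\ a_{I_m}=a_{m^*})\le q\quad\text{for all } m\le M-1,$$ where a condition is void if the conditioning event has probability $0$. Then the expected cumulative binary weak regret of DETECT, initialized at time $1$, satisfies $$\mathbb E\big[R^{\bar{\mathrm W}}(T)\big]\le\frac{ML'}2+(1-p_{\tilde T}+p\,p_{\tilde T}+q)\,MT+\sum_{m=1}^M\mathbb E\big[\tilde R^{\bar{\mathrm W}}(\nu_{m-1},\nu_{m-1}+\tilde T-1)\big],$$ where $\tilde R^{\bar{\mathrm W}}(t_1,t_2)$ denotes the cumulative binary weak regret that $Alg$ incurs when it is initialized at time $t_1$ and run on its own on the time steps $t_1,\dots,t_2$. -/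

import Mathlib

noncomputable section

namespace DuelingBandits

/-! ## Discrete probability -/

/-- Expectation of `f` under the discrete law `μ` (all subsets are measurable). -/
def expect {α : Type*} (μ : PMF α) (f : α → ℝ) : ℝ :=
  letI : MeasurableSpace α := ⊤
  MeasureTheory.integral μ.toMeasure f

/-- Conditional probability of `A` given `B` under the discrete law `μ`. -/
def condProb {α : Type*} (μ : PMF α) (A B : Set α) : ℝ :=
  letI : MeasurableSpace α := ⊤
  (ProbabilityTheory.cond μ.toMeasure B).real A

/-! ## The non-stationary dueling bandits problem -/

/-- A problem instance with `K` arms, horizon `T`, and `M` stationary segments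
`S_m = {ν (m-1), …, ν m - 1}`, `1 ≤ m ≤ M`, where `ν 0 = 1` and `ν M = T + 1`.  Only the values
`ν 0, …, ν M`, `pref 1, …, pref M` and `cw 1, …, cw M` matter. -/
structure Problem (K : ℕ) where
  /-- time horizon -/
  T : ℕ
  /-- number of stationary segments -/
  M : ℕ
  /-- changepoints -/
  ν : ℕ → ℕ
  /-- `pref m i j` is the probability that arm `i` beats arm `j` in segment `m` -/
  pref : ℕ → Fin K → Fin K → unitInterval
  /-- the Condorcet winner of each segment -/
  cw : ℕ → Fin K
  one_le_M : 1 ≤ M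
  ν_zero : ν 0 = 1
  ν_last : ν M = T + 1
  ν_lt : ∀ m < M, ν m < ν (m + 1)
  pref_add : ∀ m, 1 ≤ m → m ≤ M → ∀ i j, (pref m i j : ℝ) + (pref m j i : ℝ) = 1
  cw_beats : ∀ m, 1 ≤ m → m ≤ M → ∀ i, i ≠ cw m → (1 / 2 : ℝ) < (pref m (cw m) i : ℝ)

namespace Problem

variable {K : ℕ} (E : Problem K)

/-- The index `m` of the segment containing the time step `t`, for `1 ≤ t ≤ T`: the number of
`k ∈ {0, …, M - 1}` with `ν k ≤ t`. -/
def seg (t : ℕ) : ℕ := ((Finset.range E.M).filter fun k => E.ν k ≤ t).card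

/-- The length `|S_m|` of the `m`-th segment. -/
def segLen (m : ℕ) : ℕ := E.ν m - E.ν (m - 1)

/-- The preference matrix in force at time `t`. -/
def prefAt (t : ℕ) : Fin K → Fin K → unitInterval := E.pref (E.seg t)

/-- The suboptimality gap of arm `i` in segment `m`. -/
def gap (m : ℕ) (i : Fin K) : ℝ := (E.pref m (E.cw m) i : ℝ) - 1 / 2

/-- The binary weak regret of playing the pair `(i, j)` at time `t`. -/
def weakRegret (t : ℕ) (i j : Fin K) : ℝ :=
  (⌈min (E.gap (E.seg t) i) (E.gap (E.seg t) j)⌉ : ℤ)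

/-- The largest change, at the `m`-th changepoint, of a winning probability of the Condorcet
winner of segment `m`. -/
def deltaStar (m : ℕ) : ℝ :=
  ⨆ j : Fin K, |(E.pref (m + 1) (E.cw m) j : ℝ) - (E.pref m (E.cw m) j : ℝ)|

end Problem

/-! ## The black-box algorithm -/

/-- An observed duel `(i, j, x)`: the pair `(i, j)` was played, and `x = true` iff `i` won. -/
abbrev Duel (K : ℕ) := Fin K × Fin K × Bool

/-- The random outcome of a duel in which the first arm wins with probability `p`. -/
def duelOutcome (p : unitInterval) : PMF Bool :=
  PMF.ofFintype
    (fun x => if x = true then ENNReal.ofReal (p : ℝ) else ENNReal.ofReal (1 - (p : ℝ))) (by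
      have h0 : (0 : ℝ) ≤ p := p.2.1
      have h1 : (0 : ℝ) ≤ 1 - p := sub_nonneg.2 p.2.2
      simp [← ENNReal.ofReal_add h0 h1])

/-- An arbitrary, possibly randomized, dueling bandits algorithm.  Given what it has observed since
its initialization (most recent duel first), it has a conditional law for the pair it plays next
and a conditional law for the arm that it names as suspected Condorcet winner.  Resetting it means
going back to the empty history. -/
structure Algorithm (K : ℕ) where
  choose : List (Duel K) → PMF (Fin K × Fin K)
  suspect : List (Duel K) → PMF (Fin K)

namespace Algorithm

variable {K : ℕ} (A : Algorithm K)

/-- One time step of the algorithm with history `h` facing the preference matrix `P`: it chooses a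
pair and receives the outcome. -/
def runAndFeed (P : Fin K → Fin K → unitInterval) (h : List (Duel K)) : PMF (Duel K) :=
  (A.choose h).bind fun ij => (duelOutcome (P ij.1 ij.2)).map fun x => (ij.1, ij.2, x)

/-- The law of the history (most recent duel first) when the algorithm is run on its own for `n`
time steps, starting at time `t₀`, with preference matrix `P t` at time `t`. -/
def run (P : ℕ → Fin K → Fin K → unitInterval) (t₀ : ℕ) : ℕ → PMF (List (Duel K))
  | 0 => PMF.pure []
  | n + 1 => (run P t₀ n).bind fun h => (A.runAndFeed (P (t₀ + n)) h).map fun d => d :: h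

/-- The probability that the suspected Condorcet winner named after `n` time steps is the arm `i`,
in the stationary setting with preference matrix `P`. -/
def identProb (P : Fin K → Fin K → unitInterval) (n : ℕ) (i : Fin K) : ℝ :=
  (((A.run (fun _ => P) 1 n).bind A.suspect) i).toReal

/-- The cumulative binary weak regret of a history (most recent duel first) begun at time `t₀`. -/
def histRegret (E : Problem K) (t₀ : ℕ) : List (Duel K) → ℝ
  | [] => 0
  | d :: h => E.weakRegret (t₀ + h.length) d.1 d.2.1 + histRegret E t₀ h

/-- The expected cumulative binary weak regret that the algorithm incurs when it is run on its own
on the time steps `t₀, …, t₀ + n - 1`. -/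
def expRegret (E : Problem K) (t₀ n : ℕ) : ℝ :=
  expect (A.run E.prefAt t₀ n) (histRegret E t₀)

end Algorithm

/-! ## DETECT -/

/-- The parameters of DETECT: length `Ttil` of the running phases, window length `w`, threshold
`b`, and, for each arm `i`, an ordering `order i 0, …, order i (K - 2)` of the other arms. -/
structure Params (K : ℕ) where
  Ttil : ℕ
  w : ℕ
  b : ℝ
  order : Fin K → ℕ → Fin K
  w_pos : 0 < w
  w_even : Even w
  b_pos : 0 < b
  order_bij : ∀ i, Set.BijOn (order i) (Set.Iio (K - 1)) {i}ᶜ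

/-- The number `w (K - 1)` of time steps that fill all detection windows. -/
def Params.L {K : ℕ} (D : Params K) : ℕ := D.w * (K - 1)

/-- The detection test for a pair with outcomes `l` (most recent first): at least `w` outcomes are
there, and the win counts in the two halves of the last `w` outcomes differ by more than `b`. -/
def Params.triggers {K : ℕ} (D : Params K) (l : List Bool) : Prop :=
  D.w ≤ l.length ∧
    D.b < |((((l.drop (D.w / 2)).take (D.w / 2)).count true : ℕ) : ℝ) -
      (((l.take (D.w / 2)).count true : ℕ) : ℝ)|

/-- What is recorded about one time step. -/
structure Round (K : ℕ) where
  /-- the time step -/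
  time : ℕ
  /-- first arm played -/
  fst : Fin K
  /-- second arm played -/
  snd : Fin K
  /-- the suspected Condorcet winner in use, if this is a detection step -/
  cand : Option (Fin K)
  /-- whether the changepoint detection is triggered in this step -/
  alarm : Bool

/-- The state of DETECT between two time steps. -/
inductive State (K : ℕ)
  /-- the algorithm has been running since the last reset and has seen the history `h` -/
  | running (h : List (Duel K)) : State K
  /-- detection phase with suspected Condorcet winner `i`; `d` detection steps are done, and
  `obs j` lists the outcomes of the pair `(i, j)` in this phase, most recent first -/
  | detecting (i : Fin K) (d : ℕ) (obs : Fin K → List Bool) : State K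

/-- The state at initialization and after a reset. -/
def State.init {K : ℕ} : State K := State.running []

open Classical in
/-- One detection step at time `t` with preference matrix `P`. -/
def detectStep {K : ℕ} (D : Params K) (P : Fin K → Fin K → unitInterval) (t : ℕ)
    (i : Fin K) (d : ℕ) (obs : Fin K → List Bool) : PMF (Round K × State K) :=
  let j := D.order i (d % (K - 1))
  (duelOutcome (P i j)).map fun x =>
    let obs' := Function.update obs j (x :: obs j)
    if D.triggers (obs' j) then (⟨t, i, j, some i, true⟩, State.init)
    else (⟨t, i, j, some i, false⟩, State.detecting i (d + 1) obs')

/-- One time step of DETECT at time `t` with preference matrix `P`. -/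
def step {K : ℕ} (D : Params K) (A : Algorithm K) (P : Fin K → Fin K → unitInterval) (t : ℕ) :
    State K → PMF (Round K × State K)
  | .running h =>
      if h.length < D.Ttil then
        (A.runAndFeed P h).map fun x => (⟨t, x.1, x.2.1, none, false⟩, State.running (x :: h))
      else
        (A.suspect h).bind fun i => detectStep D P t i 0 fun _ => []
  | .detecting i d obs => detectStep D P t i d obs

/-- The law of the rounds (in chronological order) of `n` time steps of DETECT in the environment
`E`, the first of them at time `t`, from a given state. -/
def runFrom {K : ℕ} (D : Params K) (A : Algorithm K) (E : Problem K) :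
    ℕ → ℕ → State K → PMF (List (Round K))
  | 0, _, _ => PMF.pure []
  | n + 1, t, s =>
      (step D A (E.prefAt t) t s).bind fun r =>
        (runFrom D A E n (t + 1) r.2).map fun ω => r.1 :: ω

/-- The law of the rounds `t₀, …, T` of DETECT initialized at time `t₀`. -/
def detect {K : ℕ} (D : Params K) (A : Algorithm K) (E : Problem K) (t₀ : ℕ) :
    PMF (List (Round K)) :=
  runFrom D A E (E.T + 1 - t₀) t₀ State.init

/-- The first time step at which the changepoint detection is triggered (`⊤` if there is none). -/
def alarmTime {K : ℕ} : List (Round K) → ℕ∞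
  | [] => ⊤
  | r :: ω => if r.alarm then (r.time : ℕ∞) else alarmTime ω

/-- The first suspected Condorcet winner that the black-box algorithm returns, if any. -/
def firstSuspect {K : ℕ} : List (Round K) → Option (Fin K)
  | [] => none
  | r :: ω => r.cand.or (firstSuspect ω)

/-- The cumulative binary weak regret of a sequence of rounds. -/
def totalRegret {K : ℕ} (E : Problem K) (ω : List (Round K)) : ℝ :=
  (ω.map fun r => E.weakRegret r.time r.fst r.snd).sum

/-- The event that the first suspected Condorcet winner is the Condorcet winner of segment `m`. -/
def correctEvent {K : ℕ} (E : Problem K) (m : ℕ) : Set (List (Round K)) :=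
  {ω | firstSuspect ω = some (E.cw m)}

end DuelingBandits

end

/-
The regret is bounded by backward induction over the segments, for DETECT restarted anywhere in the
first `L / 2` steps of a segment `m` and not only at its first step. In the course of the segment
DETECT pays for the running phase, for a detection delay of at most `L / 2` steps, and, with the
whole horizon `T`, for the event that the suspected Condorcet winner is wrong, that there is a false
alarm, or that the alarm is late. Otherwise it is restarted in the first `L / 2` steps of segment
`m + 1`, and its detection phase is free of regret up to the changepoint because the Condorcet
winner is in every duel.

The false-alarm and delay probabilities are only given for restarts at `ν (m - 1)`. A restart at
`t > ν (m - 1)` amounts to deleting the oldest duels of every pair. This can only remove alarms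
before `ν m`. It cannot decrease the probability that the first alarm comes in the `L / 2` steps
after `ν m` either: by then all windows are full, so the tests after the change do not see the
deleted duels, and more detection phases survive until `ν m`. Since different pairs are tested on
disjoint sets of independent duels, the probability of no alarm is a product over the pairs, and
both comparisons can be made pair by pair.
-/

noncomputable section

namespace DuelingBandits

open scoped ENNReal

variable {K : ℕ}

/-! ## Expectations and probabilities of discrete laws -/

section Expectation

variable {α β : Type*} (μ : PMF α)

/-- The expectation of a `ℝ≥0∞`-valued function under the discrete law `μ`. It bounds `expect` from
above without any summability condition. -/
def lexpect (f : α → ℝ≥0∞) : ℝ≥0∞ := ∑' a, μ a * f a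

@[simp]
theorem lexpect_pure (a : α) (f : α → ℝ≥0∞) : lexpect (PMF.pure a) f = f a := by
  rw [lexpect, tsum_eq_single a fun b hb => by simp [hb]]
  simp

theorem lexpect_bind (k : α → PMF β) (f : β → ℝ≥0∞) :
    lexpect (μ.bind k) f = lexpect μ fun a => lexpect (k a) f := by
  simp only [lexpect, PMF.bind_apply, ← ENNReal.tsum_mul_right, ← ENNReal.tsum_mul_left, mul_assoc]
  exact ENNReal.tsum_comm

theorem lexpect_map (g : α → β) (f : β → ℝ≥0∞) :
    lexpect (μ.map g) f = lexpect μ fun a => f (g a) := by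
  simp only [PMF.map, lexpect_bind, Function.comp_apply, lexpect_pure]

variable {μ} in
theorem lexpect_mono {f g : α → ℝ≥0∞} (h : ∀ a ∈ μ.support, f a ≤ g a) :
    lexpect μ f ≤ lexpect μ g := by
  refine ENNReal.tsum_le_tsum fun a => ?_
  by_cases ha : μ a = 0
  · simp [ha]
  · gcongr
    exact h a ((PMF.mem_support_iff _ _).2 ha)

variable {μ} in
theorem lexpect_congr {f g : α → ℝ≥0∞} (h : ∀ a ∈ μ.support, f a = g a) :
    lexpect μ f = lexpect μ g :=
  (lexpect_mono fun a ha => (h a ha).le).antisymm (lexpect_mono fun a ha => (h a ha).ge)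

theorem lexpect_add (f g : α → ℝ≥0∞) :
    (lexpect μ fun a => f a + g a) = lexpect μ f + lexpect μ g := by
  simp only [lexpect, mul_add, ENNReal.tsum_add]

theorem lexpect_const (c : ℝ≥0∞) : (lexpect μ fun _ => c) = c := by
  simp only [lexpect, ENNReal.tsum_mul_right, PMF.tsum_coe, one_mul]

theorem lintegral_toMeasure (f : α → ℝ≥0∞) :
    (letI : MeasurableSpace α := ⊤; ∫⁻ a, f a ∂μ.toMeasure) = lexpect μ f := by
  let _ : MeasurableSpace α := ⊤
  have toMeasure_eq_sum_dirac : μ.toMeasure =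
      MeasureTheory.Measure.sum fun a => μ a • MeasureTheory.Measure.dirac a := by
    ext s hs
    rw [PMF.toMeasure_apply _ hs, MeasureTheory.Measure.sum_apply _ hs]
    refine tsum_congr fun a => ?_
    by_cases ha : a ∈ s <;> simp [ha]
  rw [toMeasure_eq_sum_dirac, MeasureTheory.lintegral_sum_measure]
  simp [lexpect]

variable {μ} in
theorem expect_le_of_lexpect_le {f : α → ℝ} {c : ℝ} (hc : 0 ≤ c)
    (h : (lexpect μ fun a => ENNReal.ofReal (f a)) ≤ ENNReal.ofReal c) : expect μ f ≤ c := by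
  let _ : MeasurableSpace α := ⊤
  change ∫ a, f a ∂μ.toMeasure ≤ c
  by_cases hf : MeasureTheory.Integrable f μ.toMeasure
  · rw [MeasureTheory.integral_eq_lintegral_pos_part_sub_lintegral_neg_part hf]
    refine (sub_le_self _ ENNReal.toReal_nonneg).trans ?_
    rw [lintegral_toMeasure]
    exact ENNReal.toReal_le_of_le_ofReal hc h
  · rwa [MeasureTheory.integral_undef hf]

variable {μ} in
theorem ofReal_expect {f : α → ℝ} (hf : ∀ a ∈ μ.support, 0 ≤ f a)
    (h : (lexpect μ fun a => ENNReal.ofReal (f a)) ≠ ∞) :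
    ENNReal.ofReal (expect μ f) = lexpect μ fun a => ENNReal.ofReal (f a) := by
  let _ : MeasurableSpace α := ⊤
  have hf' : 0 ≤ᵐ[μ.toMeasure] f := by
    rw [Filter.EventuallyLE, MeasureTheory.ae_iff,
      PMF.toMeasure_apply_eq_zero_iff _ MeasurableSpace.measurableSet_top, Set.disjoint_left]
    exact fun a ha hna => hna (hf a ha)
  change ENNReal.ofReal (∫ a, f a ∂μ.toMeasure) = _
  rw [MeasureTheory.integral_eq_lintegral_of_nonneg_ae hf' measurable_from_top.aestronglyMeasurable,
    lintegral_toMeasure, ENNReal.ofReal_toReal h]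

theorem lexpect_le_of_forall_ne_le {f : α → ℝ≥0∞} (a : α) {y B : ℝ} (hy : 0 ≤ y) (hB : 0 ≤ B)
    (ha : f a ≤ ENNReal.ofReal y) (h : ∀ b, b ≠ a → f b ≤ ENNReal.ofReal B) :
    lexpect μ f ≤ ENNReal.ofReal ((μ a).toReal * y + (1 - (μ a).toReal) * B) := by
  classical
  have hμa : ENNReal.ofReal (μ a).toReal = μ a := ENNReal.ofReal_toReal (μ.apply_ne_top a)
  have hμa_le : (μ a).toReal ≤ 1 := ENNReal.toReal_mono ENNReal.one_ne_top (μ.coe_le_one a)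
  have rest : ∑' b, (if b = a then 0 else μ b) = ENNReal.ofReal (1 - (μ a).toReal) := by
    have total := ENNReal.tsum_eq_add_tsum_ite (f := μ) a
    rw [μ.tsum_coe] at total
    rw [ENNReal.ofReal_sub _ ENNReal.toReal_nonneg, ENNReal.ofReal_one, hμa]
    exact ENNReal.eq_sub_of_add_eq' ENNReal.one_ne_top (by rw [add_comm, ← total])
  calc lexpect μ f = μ a * f a + ∑' b, if b = a then 0 else μ b * f b :=
        ENNReal.tsum_eq_add_tsum_ite a
    _ ≤ μ a * ENNReal.ofReal y + ∑' b, (if b = a then 0 else μ b) * ENNReal.ofReal B := by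
        gcongr with b
        split_ifs with hb
        · simp
        · gcongr
          exact h b hb
    _ = ENNReal.ofReal ((μ a).toReal * y + (1 - (μ a).toReal) * B) := by
        rw [ENNReal.tsum_mul_right, rest, ← ENNReal.ofReal_mul (sub_nonneg.2 hμa_le),
          ENNReal.ofReal_add (mul_nonneg ENNReal.toReal_nonneg hy)
            (mul_nonneg (sub_nonneg.2 hμa_le) hB), ENNReal.ofReal_mul ENNReal.toReal_nonneg, hμa]

/-- The probability of the event `S` under the discrete law `μ`, as a real number. -/
def prob (S : Set α) : ℝ := (μ.toOuterMeasure S).toReal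

theorem toMeasure_real_eq_prob (S : Set α) :
    (letI : MeasurableSpace α := ⊤; μ.toMeasure.real S) = prob μ S := by
  let _ : MeasurableSpace α := ⊤
  exact congrArg ENNReal.toReal
    (PMF.toMeasure_apply_eq_toOuterMeasure_apply _ MeasurableSpace.measurableSet_top)

theorem prob_inter_add_prob_diff (B S : Set α) : prob μ (B ∩ S) + prob μ (B \ S) = prob μ B := by
  let _ : MeasurableSpace α := ⊤
  simpa only [← toMeasure_real_eq_prob] using
    MeasureTheory.measureReal_inter_add_sdiff (μ := μ.toMeasure) (s := B)
      MeasurableSpace.measurableSet_top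

variable {μ} in
theorem prob_inter_le_of_condProb_le {A B : Set α} {p : ℝ} (h : condProb μ A B ≤ p) :
    prob μ (B ∩ A) ≤ p * prob μ B := by
  let _ : MeasurableSpace α := ⊤
  simp only [← toMeasure_real_eq_prob]
  change (ProbabilityTheory.cond μ.toMeasure B).real A ≤ p at h
  rw [MeasureTheory.measureReal_def, ← ProbabilityTheory.cond_mul_eq_inter
    MeasurableSpace.measurableSet_top, ENNReal.toReal_mul]
  exact mul_le_mul_of_nonneg_right h ENNReal.toReal_nonneg

end Expectation

section DuelMean

/-- The expectation of `f` of the outcome of a duel that is won with probability `p`. -/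
def duelMean (p : unitInterval) (f : Bool → ℝ) : ℝ := p * f true + (1 - p) * f false

variable (p : unitInterval)

theorem duelMean_mono {f g : Bool → ℝ} (h : ∀ x, f x ≤ g x) : duelMean p f ≤ duelMean p g :=
  add_le_add (mul_le_mul_of_nonneg_left (h true) p.2.1)
    (mul_le_mul_of_nonneg_left (h false) (sub_nonneg.2 p.2.2))

theorem duelMean_const (c : ℝ) : (duelMean p fun _ => c) = c := by
  unfold duelMean
  ring

theorem duelMean_nonneg {f : Bool → ℝ} (h : ∀ x, 0 ≤ f x) : 0 ≤ duelMean p f :=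
  (duelMean_const p 0).ge.trans (duelMean_mono p h)

theorem duelMean_le {f : Bool → ℝ} {c : ℝ} (h : ∀ x, f x ≤ c) : duelMean p f ≤ c :=
  (duelMean_mono p h).trans (duelMean_const p c).le

theorem duelMean_add (f g : Bool → ℝ) :
    (duelMean p fun x => f x + g x) = duelMean p f + duelMean p g := by
  unfold duelMean
  ring

theorem duelMean_sub (f g : Bool → ℝ) :
    (duelMean p fun x => f x - g x) = duelMean p f - duelMean p g := by
  unfold duelMean
  ring

theorem duelMean_const_mul (c : ℝ) (f : Bool → ℝ) :
    (duelMean p fun x => c * f x) = c * duelMean p f := by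
  unfold duelMean
  ring

theorem lexpect_duelOutcome_ofReal {f : Bool → ℝ} (hf : ∀ x, 0 ≤ f x) :
    (lexpect (duelOutcome p) fun x => ENNReal.ofReal (f x)) = ENNReal.ofReal (duelMean p f) := by
  have hp : (0 : ℝ) ≤ 1 - p := sub_nonneg.2 p.2.2
  rw [duelMean, ENNReal.ofReal_add (mul_nonneg p.2.1 (hf _)) (mul_nonneg hp (hf _)),
    ENNReal.ofReal_mul p.2.1, ENNReal.ofReal_mul hp]
  simp [lexpect, duelOutcome]

end DuelMean

/-! ## The test of a single pair -/

open Classical in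
/-- The probability that the detection test of one pair never triggers while the outcomes of duels
won with probabilities `ps` are successively added to the outcomes `o` (most recent first). -/
def Params.noTriggerProb (D : Params K) : List unitInterval → List Bool → ℝ
  | [], _ => 1
  | p :: ps, o =>
      duelMean p fun x => if D.triggers (x :: o) then 0 else D.noTriggerProb ps (x :: o)

namespace Params

variable (D : Params K)

theorem w_half_add_w_half : D.w / 2 + D.w / 2 = D.w := by
  obtain ⟨r, hr⟩ := D.w_even
  omega

theorem triggers_append_singleton {o : List Bool} (ho : D.w ≤ o.length) (y : Bool) :
    D.triggers (o ++ [y]) ↔ D.triggers o := by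
  have half := D.w_half_add_w_half
  unfold triggers
  rw [List.drop_append_of_le_length (by omega),
    List.take_append_of_le_length (by rw [List.length_drop]; omega),
    List.take_append_of_le_length (by omega)]
  simp only [ho, List.length_append, List.length_singleton, true_and, and_iff_right_iff_imp]
  omega

theorem triggers.append_singleton {D : Params K} {o : List Bool} (h : D.triggers o) (y : Bool) :
    D.triggers (o ++ [y]) :=
  (D.triggers_append_singleton h.1 y).2 h

theorem noTriggerProb_nonneg (ps : List unitInterval) (o : List Bool) :
    0 ≤ D.noTriggerProb ps o := by
  induction ps generalizing o with
  | nil => exact zero_le_one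
  | cons p ps ih =>
    refine duelMean_nonneg p fun x => ?_
    split_ifs
    exacts [le_rfl, ih _]

theorem noTriggerProb_append_le (ps qs : List unitInterval) (o : List Bool) :
    D.noTriggerProb (ps ++ qs) o ≤ D.noTriggerProb ps o := by
  induction ps generalizing o with
  | nil =>
    induction qs generalizing o with
    | nil => exact le_rfl
    | cons q qs ih =>
      refine duelMean_le q fun x => ?_
      split_ifs
      exacts [zero_le_one, ih _]
  | cons p ps ih =>
    refine duelMean_mono p fun x => ?_
    split_ifs
    exacts [le_rfl, ih _]

theorem noTriggerProb_le_one (ps : List unitInterval) (o : List Bool) :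
    D.noTriggerProb ps o ≤ 1 :=
  D.noTriggerProb_append_le [] ps o

/- Outcomes are listed most recent first, so `o ++ [y]` is `o` with an older duel added. -/
theorem noTriggerProb_append_singleton_le (ps : List unitInterval) (o : List Bool) (y : Bool) :
    D.noTriggerProb ps (o ++ [y]) ≤ D.noTriggerProb ps o := by
  induction ps generalizing o with
  | nil => exact le_rfl
  | cons p ps ih =>
    refine duelMean_mono p fun x => ?_
    simp only [← List.cons_append]
    split_ifs with older h h
    exacts [le_rfl, D.noTriggerProb_nonneg _ _, absurd (h.append_singleton y) older, ih (x :: o)]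

theorem noTriggerProb_append_singleton_of_le_length (ps : List unitInterval) {o : List Bool}
    (ho : D.w ≤ o.length) (y : Bool) : D.noTriggerProb ps (o ++ [y]) = D.noTriggerProb ps o := by
  induction ps generalizing o with
  | nil => rfl
  | cons p ps ih =>
    refine congrArg (duelMean p) (funext fun x => ?_)
    have hx : D.w ≤ (x :: o).length := ho.trans (Nat.le_succ _)
    rw [← List.cons_append, ih hx, propext (D.triggers_append_singleton hx y)]

theorem noTriggerProb_sub_append_singleton_le (ps qs : List unitInterval) {o : List Bool}
    (ho : D.w ≤ o.length + ps.length) (y : Bool) :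
    D.noTriggerProb ps (o ++ [y]) - D.noTriggerProb (ps ++ qs) (o ++ [y]) ≤
      D.noTriggerProb ps o - D.noTriggerProb (ps ++ qs) o := by
  induction ps generalizing o with
  | nil =>
    rw [List.nil_append, D.noTriggerProb_append_singleton_of_le_length qs (by simpa using ho)]
    exact le_rfl
  | cons p ps ih =>
    simp only [List.cons_append, noTriggerProb, ← duelMean_sub]
    refine duelMean_mono p fun x => ?_
    simp only [← List.cons_append]
    split_ifs with older h h
    · exact le_rfl
    · rw [sub_zero]
      exact sub_nonneg.2 (D.noTriggerProb_append_le _ _ _)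
    · exact absurd (h.append_singleton y) older
    · exact ih (o := x :: o) (by simp only [List.length_cons] at ho ⊢; omega)

theorem noTriggerProb_cons_le (p : unitInterval) (ps : List unitInterval) :
    D.noTriggerProb (p :: ps) [] ≤ D.noTriggerProb ps [] := by
  refine duelMean_le p fun x => ?_
  split_ifs
  exacts [D.noTriggerProb_nonneg _ _, D.noTriggerProb_append_singleton_le ps [] x]

theorem noTriggerProb_cons_sub_le (p : unitInterval) {ps : List unitInterval}
    (hps : D.w ≤ ps.length) (qs : List unitInterval) :
    D.noTriggerProb (p :: ps) [] - D.noTriggerProb (p :: ps ++ qs) [] ≤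
      D.noTriggerProb ps [] - D.noTriggerProb (ps ++ qs) [] := by
  simp only [List.cons_append, noTriggerProb, ← duelMean_sub]
  refine duelMean_le p fun x => ?_
  split_ifs
  · simpa using D.noTriggerProb_append_le ps qs []
  · exact D.noTriggerProb_sub_append_singleton_le ps qs (o := []) (by simpa using hps) x

theorem noTriggerProb_replicate_antitone (p : unitInterval) (qs : List unitInterval) :
    Antitone fun n => D.noTriggerProb (List.replicate n p ++ qs) [] :=
  antitone_nat_of_succ_le fun _ => D.noTriggerProb_cons_le p _

theorem noTriggerProb_replicate_sub_le (p : unitInterval) (qs : List unitInterval) {n n' : ℕ}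
    (hn : D.w ≤ n) (h : n ≤ n') :
    D.noTriggerProb (List.replicate n' p) [] - D.noTriggerProb (List.replicate n' p ++ qs) [] ≤
      D.noTriggerProb (List.replicate n p) [] - D.noTriggerProb (List.replicate n p ++ qs) [] := by
  induction n', h using Nat.le_induction with
  | base => exact le_rfl
  | succ k hk ih =>
    exact (D.noTriggerProb_cons_sub_le p (by simpa using hn.trans hk) qs).trans ih

end Params

/-! ## The detection phase -/

theorem Params.L_half (D : Params K) : D.L / 2 = D.w / 2 * (K - 1) := by
  rw [L, ← Nat.div_mul_cancel D.w_even.two_dvd, mul_right_comm,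
    Nat.mul_div_cancel _ two_pos, Nat.div_mul_cancel D.w_even.two_dvd]

theorem Params.L_half_add_L_half (D : Params K) : D.L / 2 + D.L / 2 = D.L := by
  rw [L_half, ← add_mul, D.w_half_add_w_half, L]

theorem Params.L_half_pos (D : Params K) (hK : 2 ≤ K) : 0 < D.L / 2 := by
  rw [L_half]
  exact Nat.mul_pos (Nat.div_pos (Nat.le_of_dvd D.w_pos D.w_even.two_dvd) two_pos) (by omega)

/-- The arm that the suspected Condorcet winner `i` duels in the detection step number `d`. -/
def Params.nextArm (D : Params K) (i : Fin K) (d : ℕ) : Fin K := D.order i (d % (K - 1))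

/-- The outcomes of all pairs after the detection step number `d` has had the outcome `x`. -/
def Params.observe (D : Params K) (i : Fin K) (d : ℕ) (obs : Fin K → List Bool) (x : Bool) :
    Fin K → List Bool :=
  Function.update obs (D.nextArm i d) (x :: obs (D.nextArm i d))

open Classical in
/-- The expectation of `φ d' obs'` on the event that `n` detection steps from time `t` on raise no
alarm, where `d'` and `obs'` are the number of detection steps and the observations after them.
With `φ = 1` it is the probability of this event, see `noAlarmProb`. -/
def noAlarmMean (D : Params K) (E : Problem K) (i : Fin K)
    (φ : ℕ → (Fin K → List Bool) → ℝ) : ℕ → ℕ → ℕ → (Fin K → List Bool) → ℝ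
  | 0, _, d, obs => φ d obs
  | n + 1, t, d, obs => duelMean (E.prefAt t i (D.nextArm i d)) fun x =>
      if D.triggers (D.observe i d obs x (D.nextArm i d)) then 0
      else noAlarmMean D E i φ n (t + 1) (d + 1) (D.observe i d obs x)

/-- The probability that `n` detection steps from time `t` on raise no alarm. -/
def noAlarmProb (D : Params K) (E : Problem K) (i : Fin K) :
    ℕ → ℕ → ℕ → (Fin K → List Bool) → ℝ :=
  noAlarmMean D E i fun _ _ => 1

/-- The success probabilities of the duels of the pair `(i, j)` in `n` detection steps from time
`t` on, of which the first is the step number `d` of the detection phase. -/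
def duelProbs (D : Params K) (E : Problem K) (i j : Fin K) : ℕ → ℕ → ℕ → List unitInterval
  | 0, _, _ => []
  | n + 1, t, d =>
      if D.nextArm i d = j then E.prefAt t i j :: duelProbs D E i j n (t + 1) (d + 1)
      else duelProbs D E i j n (t + 1) (d + 1)

section NoAlarm

variable (D : Params K) (E : Problem K) (i : Fin K)

theorem observe_self (d : ℕ) (obs : Fin K → List Bool) (x : Bool) :
    D.observe i d obs x (D.nextArm i d) = x :: obs (D.nextArm i d) :=
  Function.update_self ..

theorem observe_of_ne {d : ℕ} {j : Fin K} (hj : j ≠ D.nextArm i d) (obs : Fin K → List Bool)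
    (x : Bool) : D.observe i d obs x j = obs j :=
  Function.update_of_ne hj ..

theorem noAlarmMean_add_steps (φ : ℕ → (Fin K → List Bool) → ℝ) (n n' t d : ℕ)
    (obs : Fin K → List Bool) :
    noAlarmMean D E i φ (n + n') t d obs =
      noAlarmMean D E i (noAlarmMean D E i φ n' (t + n)) n t d obs := by
  induction n generalizing t d obs with
  | zero => rw [zero_add]; rfl
  | succ n ih =>
    rw [Nat.succ_add, noAlarmMean, noAlarmMean]
    simp only [ih, add_right_comm t 1 n, add_assoc]

theorem noAlarmProb_add_steps (n n' t d : ℕ) (obs : Fin K → List Bool) :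
    noAlarmProb D E i (n + n') t d obs =
      noAlarmMean D E i (noAlarmProb D E i n' (t + n)) n t d obs :=
  noAlarmMean_add_steps ..

theorem noAlarmMean_const_add_const_mul (C a : ℝ) (φ : ℕ → (Fin K → List Bool) → ℝ) (n t d : ℕ)
    (obs : Fin K → List Bool) :
    noAlarmMean D E i (fun d obs => C + a * φ d obs) n t d obs =
      C * noAlarmProb D E i n t d obs + a * noAlarmMean D E i φ n t d obs := by
  induction n generalizing t d obs with
  | zero => simp only [noAlarmMean, noAlarmProb, mul_one]
  | succ n ih =>
    rw [noAlarmProb] at ih ⊢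
    simp only [noAlarmMean, ← duelMean_const_mul, ← duelMean_add, ih]
    refine congrArg (duelMean _) (funext fun x => ?_)
    split_ifs <;> ring

theorem noAlarmMean_const (C : ℝ) (n t d : ℕ) (obs : Fin K → List Bool) :
    noAlarmMean D E i (fun _ _ => C) n t d obs = C * noAlarmProb D E i n t d obs := by
  simpa using noAlarmMean_const_add_const_mul D E i C 0 (fun _ _ => 0) n t d obs

theorem noAlarmMean_nonneg {φ : ℕ → (Fin K → List Bool) → ℝ} (hφ : ∀ d obs, 0 ≤ φ d obs)
    (n t d : ℕ) (obs : Fin K → List Bool) : 0 ≤ noAlarmMean D E i φ n t d obs := by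
  induction n generalizing t d obs with
  | zero => exact hφ d obs
  | succ n ih =>
    refine duelMean_nonneg _ fun x => ?_
    split_ifs
    exacts [le_rfl, ih _ _ _]

theorem noAlarmProb_nonneg (n t d : ℕ) (obs : Fin K → List Bool) :
    0 ≤ noAlarmProb D E i n t d obs :=
  noAlarmMean_nonneg D E i (fun _ _ => zero_le_one) n t d obs

theorem duelProbs_add_steps (j : Fin K) (n n' t d : ℕ) :
    duelProbs D E i j (n + n') t d =
      duelProbs D E i j n t d ++ duelProbs D E i j n' (t + n) (d + n) := by
  induction n generalizing t d with
  | zero => rw [zero_add]; rfl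
  | succ n ih =>
    rw [Nat.succ_add, duelProbs, duelProbs, ih, add_right_comm t, add_right_comm d, add_assoc t,
      add_assoc d]
    split_ifs <;> rfl

/-- Different pairs are tested on disjoint sets of duels, hence independently of each other. -/
theorem noAlarmProb_eq_prod (n t d : ℕ) (obs : Fin K → List Bool) :
    noAlarmProb D E i n t d obs = ∏ j, D.noTriggerProb (duelProbs D E i j n t d) (obs j) := by
  induction n generalizing t d obs with
  | zero => simp [noAlarmProb, noAlarmMean, duelProbs, Params.noTriggerProb]
  | succ n ih =>
    set j := D.nextArm i d
    set others := ∏ k ∈ Finset.univ.erase j,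
      D.noTriggerProb (duelProbs D E i k n (t + 1) (d + 1)) (obs k)
    have after (x : Bool) :
        noAlarmMean D E i (fun _ _ => 1) n (t + 1) (d + 1) (D.observe i d obs x) =
          others * D.noTriggerProb (duelProbs D E i j n (t + 1) (d + 1)) (x :: obs j) := by
      rw [← noAlarmProb, ih, ← Finset.prod_erase_mul _ _ (Finset.mem_univ j), observe_self]
      congr 1
      exact Finset.prod_congr rfl fun k hk => by
        rw [observe_of_ne D i (Finset.ne_of_mem_erase hk)]
    have others_eq : ∏ k ∈ Finset.univ.erase j,
        D.noTriggerProb (duelProbs D E i k (n + 1) t d) (obs k) = others :=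
      Finset.prod_congr rfl fun k hk => by
        rw [duelProbs, if_neg (Finset.ne_of_mem_erase hk).symm]
    rw [← Finset.prod_erase_mul _ _ (Finset.mem_univ j), others_eq, duelProbs, if_pos rfl,
      Params.noTriggerProb, ← duelMean_const_mul, noAlarmProb, noAlarmMean]
    refine congrArg (duelMean _) (funext fun x => ?_)
    rw [after, observe_self, mul_ite, mul_zero]

theorem noAlarmProb_le_one (n t d : ℕ) (obs : Fin K → List Bool) :
    noAlarmProb D E i n t d obs ≤ 1 := by
  rw [noAlarmProb_eq_prod]
  exact Finset.prod_le_one (fun _ _ => D.noTriggerProb_nonneg _ _)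
    fun _ _ => D.noTriggerProb_le_one _ _

end NoAlarm

/-- The number of duels of the pair `(i, j)` in `n` detection steps, of which the first is the step
number `d` of the detection phase. -/
def Params.duelCount (D : Params K) (i j : Fin K) (d n : ℕ) : ℕ :=
  Nat.count (fun k => D.nextArm i (d + k) = j) n

section RoundRobin

variable (D : Params K) (E : Problem K) (i : Fin K)

theorem duelCount_mono (j : Fin K) (d : ℕ) : Monotone (D.duelCount i j d) :=
  Nat.count_monotone _

theorem duelProbs_eq_replicate (j : Fin K) (P : Fin K → Fin K → unitInterval) (n t d : ℕ)
    (hP : ∀ k < n, E.prefAt (t + k) = P) :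
    duelProbs D E i j n t d = List.replicate (D.duelCount i j d n) (P i j) := by
  induction n generalizing t d with
  | zero => simp [duelProbs, Params.duelCount]
  | succ n ih =>
    have now : E.prefAt t = P := hP 0 (Nat.succ_pos n)
    have later := ih (t + 1) (d + 1) fun k hk => by
      rw [add_assoc, add_comm 1]
      exact hP (k + 1) (by omega)
    rw [duelProbs, later, Params.duelCount, Params.duelCount, Nat.count_succ', now]
    simp only [add_zero, add_assoc, add_comm 1]
    split_ifs <;> simp [List.replicate_succ]

variable {i}

theorem duelCount_self (hK : 2 ≤ K) (d n : ℕ) : D.duelCount i i d n = 0 := by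
  rw [Params.duelCount, Nat.count_eq_card_filter_range, Finset.card_eq_zero,
    Finset.filter_eq_empty_iff]
  exact fun k _ => (D.order_bij i).mapsTo (Nat.mod_lt _ (by omega) : (d + k) % (K - 1) < K - 1)

theorem duelCount_period {j : Fin K} (hj : j ≠ i) (d : ℕ) : D.duelCount i j d (K - 1) = 1 := by
  have first_round : Nat.count (fun k => D.order i (k % (K - 1)) = j) (K - 1) = 1 := by
    obtain ⟨r, hr, hrj⟩ := (D.order_bij i).surjOn (show j ∈ ({i} : Set (Fin K))ᶜ from hj)
    rw [Nat.count_eq_card_filter_range, Finset.card_eq_one]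
    refine ⟨r, Finset.ext fun k => ?_⟩
    rw [Finset.mem_filter, Finset.mem_range, Finset.mem_singleton]
    constructor
    · rintro ⟨hk, hkj⟩
      rw [Nat.mod_eq_of_lt hk] at hkj
      exact (D.order_bij i).injOn hk hr (hkj.trans hrj.symm)
    · rintro rfl
      exact ⟨hr, by rwa [Nat.mod_eq_of_lt hr]⟩
  have count_eq := Nat.count_add (fun k => D.order i (k % (K - 1)) = j) d (K - 1)
  rw [add_comm d (K - 1), Nat.count_add] at count_eq
  simp only [Nat.add_mod_left] at count_eq
  exact (Nat.add_left_cancel ((add_comm _ _).trans count_eq)).symm.trans first_round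

theorem duelCount_mul_period {j : Fin K} (hj : j ≠ i) (d r : ℕ) :
    D.duelCount i j d (r * (K - 1)) = r := by
  induction r with
  | zero => simp [Params.duelCount]
  | succ r ih =>
    rw [Params.duelCount, Nat.succ_mul, Nat.count_add, ← Params.duelCount, ih]
    simpa only [Params.duelCount, add_assoc] using
      congrArg (r + ·) (duelCount_period D hj (d + r * (K - 1)))

theorem duelCount_L_half (hK : 2 ≤ K) (j : Fin K) (d : ℕ) :
    D.duelCount i j d (D.L / 2) = if j = i then 0 else D.w / 2 := by
  split_ifs with hj
  · rw [hj, duelCount_self D hK]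
  · rw [D.L_half, duelCount_mul_period D hj]

end RoundRobin

/-! ## Coupling detection phases begun at different times -/

theorem prod_sub_prod_le_prod_sub_prod {ι R : Type*} [CommRing R] [PartialOrder R]
    [IsOrderedRing R] {s : Finset ι} {u v u' v' : ι → R}
    (hv : ∀ j ∈ s, 0 ≤ v j) (hvu : ∀ j ∈ s, v j ≤ u j)
    (hu : ∀ j ∈ s, u j ≤ u' j) (hvv' : ∀ j ∈ s, v j ≤ v' j)
    (h : ∀ j ∈ s, u j - v j ≤ u' j - v' j) :
    ∏ j ∈ s, u j - ∏ j ∈ s, v j ≤ ∏ j ∈ s, u' j - ∏ j ∈ s, v' j := by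
  classical
  induction s using Finset.induction_on with
  | empty => simp
  | insert a s ha ih =>
    rw [Finset.forall_mem_insert] at hv hvu hu hvv' h
    obtain ⟨hva, hv⟩ := hv
    obtain ⟨hvua, hvu⟩ := hvu
    obtain ⟨-, hu⟩ := hu
    obtain ⟨hvva, hvv'⟩ := hvv'
    obtain ⟨h_a, h⟩ := h
    have prod_nonneg : 0 ≤ ∏ j ∈ s, u j :=
      Finset.prod_nonneg fun j hj => (hv j hj).trans (hvu j hj)
    have prod_u_le : ∏ j ∈ s, u j ≤ ∏ j ∈ s, u' j :=
      Finset.prod_le_prod (fun j hj => (hv j hj).trans (hvu j hj)) hu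
    have prod_v_le : ∏ j ∈ s, v j ≤ ∏ j ∈ s, u j := Finset.prod_le_prod hv hvu
    simp only [Finset.prod_insert ha]
    calc u a * ∏ j ∈ s, u j - v a * ∏ j ∈ s, v j
        = (u a - v a) * ∏ j ∈ s, u j + v a * (∏ j ∈ s, u j - ∏ j ∈ s, v j) := by ring
      _ ≤ (u' a - v' a) * ∏ j ∈ s, u' j + v' a * (∏ j ∈ s, u' j - ∏ j ∈ s, v' j) :=
          add_le_add
            (mul_le_mul h_a prod_u_le prod_nonneg ((sub_nonneg.2 hvua).trans h_a))
            (mul_le_mul hvva (ih hv hvu hu hvv' h) (sub_nonneg.2 prod_v_le) (hva.trans hvva))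
      _ = u' a * ∏ j ∈ s, u' j - v' a * ∏ j ∈ s, v' j := by ring

/-- The probability that a detection phase for the arm `i` begun at time `t` raises no alarm before
time `s`. -/
def quietProb (D : Params K) (E : Problem K) (i : Fin K) (t s : ℕ) : ℝ :=
  noAlarmProb D E i (s - t) t 0 fun _ => []

theorem quietProb_nonneg (D : Params K) (E : Problem K) (i : Fin K) (t s : ℕ) :
    0 ≤ quietProb D E i t s :=
  noAlarmProb_nonneg ..

theorem quietProb_le_one (D : Params K) (E : Problem K) (i : Fin K) (t s : ℕ) :
    quietProb D E i t s ≤ 1 :=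
  noAlarmProb_le_one ..

section Coupling

variable (D : Params K) {E : Problem K} (i : Fin K) {P P' : Fin K → Fin K → unitInterval}
  {t t' s : ℕ}

theorem quietProb_eq_prod (hP : ∀ u, t ≤ u → u < s → E.prefAt u = P) :
    quietProb D E i t s =
      ∏ j, D.noTriggerProb (List.replicate (D.duelCount i j 0 (s - t)) (P i j)) [] := by
  rw [quietProb, noAlarmProb_eq_prod]
  refine Finset.prod_congr rfl fun j _ => ?_
  rw [duelProbs_eq_replicate D E i j P _ t 0 fun k hk => hP _ (by omega) (by omega)]

theorem quietProb_add_L_half_eq_prod (hK : 2 ≤ K) (hts : t ≤ s)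
    (hP : ∀ u, t ≤ u → u < s → E.prefAt u = P)
    (hP' : ∀ u, s ≤ u → u < s + D.L / 2 → E.prefAt u = P') :
    quietProb D E i t (s + D.L / 2) =
      ∏ j, D.noTriggerProb (List.replicate (D.duelCount i j 0 (s - t)) (P i j) ++
        List.replicate (if j = i then 0 else D.w / 2) (P' i j)) [] := by
  rw [quietProb, noAlarmProb_eq_prod, Nat.sub_add_comm hts]
  refine Finset.prod_congr rfl fun j _ => ?_
  rw [duelProbs_add_steps,
    duelProbs_eq_replicate D E i j P _ t 0 fun k hk => hP _ (by omega) (by omega),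
    duelProbs_eq_replicate D E i j P' _ _ _ fun k hk => hP' _ (by omega) (by omega),
    duelCount_L_half D hK]

theorem quietProb_le_of_le (ht : t' ≤ t) (hP : ∀ u, t' ≤ u → u < s → E.prefAt u = P) :
    quietProb D E i t' s ≤ quietProb D E i t s := by
  rw [quietProb_eq_prod D i hP, quietProb_eq_prod D i fun u hu => hP u (ht.trans hu)]
  refine Finset.prod_le_prod (fun _ _ => D.noTriggerProb_nonneg _ _) fun j _ => ?_
  simpa using D.noTriggerProb_replicate_antitone (P i j) []
    (duelCount_mono D i j 0 (Nat.sub_le_sub_left ht s))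

/- Round-robin play gives each pair the same number of duels in every stretch of `L / 2` steps, so
both phases see the same duels after the change, and `L` steps before it fill all windows. -/
theorem quietProb_sub_le_of_le (hK : 2 ≤ K) (ht : t' ≤ t) (hts : t + D.L ≤ s)
    (hP : ∀ u, t' ≤ u → u < s → E.prefAt u = P)
    (hP' : ∀ u, s ≤ u → u < s + D.L / 2 → E.prefAt u = P') :
    quietProb D E i t' s - quietProb D E i t' (s + D.L / 2) ≤
      quietProb D E i t s - quietProb D E i t (s + D.L / 2) := by
  have hPt : ∀ u, t ≤ u → u < s → E.prefAt u = P := fun u hu => hP u (ht.trans hu)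
  have count_le (j : Fin K) : D.duelCount i j 0 (s - t) ≤ D.duelCount i j 0 (s - t') :=
    duelCount_mono D i j 0 (Nat.sub_le_sub_left ht s)
  have windows_full (j : Fin K) (hj : j ≠ i) : D.w ≤ D.duelCount i j 0 (s - t) := by
    rw [← duelCount_mul_period D hj 0 D.w]
    exact duelCount_mono D i j 0 (by unfold Params.L at hts; omega)
  rw [quietProb_eq_prod D i hP, quietProb_eq_prod D i hPt,
    quietProb_add_L_half_eq_prod D i hK (by omega) hP hP',
    quietProb_add_L_half_eq_prod D i hK (by omega) hPt hP']
  refine prod_sub_prod_le_prod_sub_prod (fun j _ => D.noTriggerProb_nonneg _ _)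
    (fun j _ => D.noTriggerProb_append_le _ _ _) (fun j _ => ?_)
    (fun j _ => D.noTriggerProb_replicate_antitone _ _ (count_le j)) fun j _ => ?_
  · simpa using D.noTriggerProb_replicate_antitone (P i j) [] (count_le j)
  · by_cases hj : j = i
    · subst hj
      simp only [duelCount_self D hK, le_rfl]
    · exact D.noTriggerProb_replicate_sub_le _ _ (windows_full j hj) (count_le j)

end Coupling

/-! ## The environment and the black-box algorithm -/

namespace Problem

variable (E : Problem K)

theorem ν_le_ν {a b : ℕ} (hab : a ≤ b) (hb : b ≤ E.M) : E.ν a ≤ E.ν b := by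
  induction b, hab using Nat.le_induction with
  | base => exact le_rfl
  | succ b _ ih => exact (ih (by omega)).trans (E.ν_lt b (by omega)).le

theorem one_le_ν {a : ℕ} (ha : a ≤ E.M) : 1 ≤ E.ν a :=
  E.ν_zero ▸ E.ν_le_ν (Nat.zero_le a) ha

theorem ν_le_T_add_one {a : ℕ} (ha : a ≤ E.M) : E.ν a ≤ E.T + 1 :=
  E.ν_last ▸ E.ν_le_ν ha le_rfl

theorem seg_eq {m t : ℕ} (hm : m ≤ E.M) (h1 : E.ν (m - 1) ≤ t) (h2 : t < E.ν m) :
    E.seg t = m := by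
  have : ((Finset.range E.M).filter fun k => E.ν k ≤ t) = Finset.range m := by
    ext k
    simp only [Finset.mem_filter, Finset.mem_range]
    constructor
    · rintro ⟨hk, hkt⟩
      by_contra! hmk
      exact absurd (E.ν_le_ν hmk hk.le) (by omega)
    · intro hk
      exact ⟨by omega, (E.ν_le_ν (by omega : k ≤ m - 1) (by omega)).trans h1⟩
  rw [seg, this, Finset.card_range]

theorem one_le_seg {t : ℕ} (ht : 1 ≤ t) : 1 ≤ E.seg t := by
  rw [seg, Nat.one_le_iff_ne_zero, Finset.card_ne_zero]
  exact ⟨0, by simpa [E.ν_zero] using ⟨E.one_le_M, ht⟩⟩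

theorem seg_le (t : ℕ) : E.seg t ≤ E.M :=
  (Finset.card_filter_le _ _).trans (Finset.card_range _).le

theorem gap_cw {m : ℕ} (h1 : 1 ≤ m) (hm : m ≤ E.M) : E.gap m (E.cw m) = 0 := by
  have h := E.pref_add m h1 hm (E.cw m) (E.cw m)
  unfold gap
  linarith

theorem gap_nonneg {m : ℕ} (h1 : 1 ≤ m) (hm : m ≤ E.M) (i : Fin K) : 0 ≤ E.gap m i := by
  by_cases h : i = E.cw m
  · rw [h, E.gap_cw h1 hm]
  · exact (sub_pos.2 (E.cw_beats m h1 hm i h)).le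

theorem weakRegret_nonneg {t : ℕ} (ht : 1 ≤ t) (i j : Fin K) : 0 ≤ E.weakRegret t i j := by
  have h := le_min (E.gap_nonneg (E.one_le_seg ht) (E.seg_le t) i)
    (E.gap_nonneg (E.one_le_seg ht) (E.seg_le t) j)
  exact Int.cast_nonneg (Int.ceil_nonneg h)

theorem weakRegret_le_one (t : ℕ) (i j : Fin K) : E.weakRegret t i j ≤ 1 := by
  unfold weakRegret
  have h : min (E.gap (E.seg t) i) (E.gap (E.seg t) j) ≤ ((1 : ℤ) : ℝ) := by
    refine (min_le_left _ _).trans ?_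
    have := (E.pref (E.seg t) (E.cw (E.seg t)) i).2.2
    unfold gap
    push_cast
    linarith
  exact_mod_cast Int.ceil_le.2 h

theorem weakRegret_cw {m t : ℕ} (h1 : 1 ≤ m) (hm : m ≤ E.M) (hs : E.seg t = m) (j : Fin K) :
    E.weakRegret t (E.cw m) j = 0 := by
  rw [weakRegret, hs, E.gap_cw h1 hm, min_eq_left (E.gap_nonneg h1 hm j)]
  simp

end Problem

section Algorithm

variable (A : Algorithm K) (E : Problem K)

theorem length_of_mem_support_run (P : ℕ → Fin K → Fin K → unitInterval) (t n : ℕ)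
    (h : List (Duel K)) (hh : h ∈ (A.run P t n).support) : h.length = n := by
  induction n generalizing h with
  | zero =>
    rw [Algorithm.run, PMF.mem_support_pure_iff] at hh
    simp [hh]
  | succ n ih =>
    rw [Algorithm.run, PMF.mem_support_bind_iff] at hh
    obtain ⟨h', hh', hd⟩ := hh
    rw [PMF.mem_support_map_iff] at hd
    obtain ⟨d, _, rfl⟩ := hd
    simp [ih h' hh']

theorem run_eq_of_stationary {P : ℕ → Fin K → Fin K → unitInterval}
    {Q : Fin K → Fin K → unitInterval} {t n : ℕ} (h : ∀ k < n, P (t + k) = Q) :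
    A.run P t n = A.run (fun _ => Q) 1 n := by
  induction n with
  | zero => rfl
  | succ n ih => rw [Algorithm.run, Algorithm.run, ih fun k hk => h k (by omega), h n (by omega)]

end Algorithm

/-! ## The law of DETECT -/

theorem bind_congr_of_mem_support {α β : Type*} {μ : PMF α} {f g : α → PMF β}
    (h : ∀ a ∈ μ.support, f a = g a) : μ.bind f = μ.bind g := by
  ext b
  exact lexpect_congr fun a ha => congrArg (fun ν => ν b) (h a ha)

/-- The law of the rounds `t, …, T` of DETECT when it is in the state `s` at time `t`. -/
def detectFrom (D : Params K) (A : Algorithm K) (E : Problem K) (t : ℕ) (s : State K) :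
    PMF (List (Round K)) :=
  runFrom D A E (E.T + 1 - t) t s

/-- The rounds, in chronological order, of a running phase that began at time `t` and in which the
black-box algorithm has seen the given history (most recent duel first). -/
def runningRounds (t : ℕ) : List (Duel K) → List (Round K)
  | [] => []
  | d :: h => runningRounds t h ++ [⟨t + h.length, d.1, d.2.1, none, false⟩]

theorem alarmTime_runningRounds_append (t : ℕ) (h : List (Duel K)) (ω : List (Round K)) :
    alarmTime (runningRounds t h ++ ω) = alarmTime ω := by
  induction h generalizing ω with
  | nil => rfl
  | cons d h ih => rw [runningRounds, List.append_assoc, ih]; rfl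

theorem firstSuspect_runningRounds_append (t : ℕ) (h : List (Duel K)) (ω : List (Round K)) :
    firstSuspect (runningRounds t h ++ ω) = firstSuspect ω := by
  induction h generalizing ω with
  | nil => rfl
  | cons d h ih => rw [runningRounds, List.append_assoc, ih]; rfl

section Law

variable (D : Params K) (A : Algorithm K) (E : Problem K)

theorem detectFrom_eq_step_bind {t : ℕ} (ht : t ≤ E.T) (s : State K) :
    detectFrom D A E t s = (step D A (E.prefAt t) t s).bind fun r =>
      (detectFrom D A E (t + 1) r.2).map (r.1 :: ·) := by
  rw [detectFrom, Nat.sub_add_comm ht, ← Nat.add_sub_add_right _ 1 t]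
  rfl

theorem detectFrom_running {t : ℕ} (ht : t ≤ E.T) {h : List (Duel K)} (hh : h.length < D.Ttil) :
    detectFrom D A E t (State.running h) = (A.runAndFeed (E.prefAt t) h).bind fun d =>
      (detectFrom D A E (t + 1) (State.running (d :: h))).map
        ((⟨t, d.1, d.2.1, none, false⟩ : Round K) :: ·) := by
  rw [detectFrom_eq_step_bind D A E ht, step, if_pos hh, PMF.bind_map]
  rfl

theorem detectFrom_running_of_length_eq {t : ℕ} (ht : t ≤ E.T) {h : List (Duel K)}
    (hh : h.length = D.Ttil) :
    detectFrom D A E t (State.running h) =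
      (A.suspect h).bind fun i => detectFrom D A E t (State.detecting i 0 fun _ => []) := by
  simp only [detectFrom_eq_step_bind D A E ht, step, hh, lt_irrefl, if_false, PMF.bind_bind]

open Classical in
theorem detectFrom_detecting {t : ℕ} (ht : t ≤ E.T) (i : Fin K) (d : ℕ)
    (obs : Fin K → List Bool) :
    detectFrom D A E t (State.detecting i d obs) =
      (duelOutcome (E.prefAt t i (D.nextArm i d))).bind fun x =>
        if D.triggers (D.observe i d obs x (D.nextArm i d)) then
          (detect D A E (t + 1)).map (⟨t, i, D.nextArm i d, some i, true⟩ :: ·)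
        else
          (detectFrom D A E (t + 1) (State.detecting i (d + 1) (D.observe i d obs x))).map
            (⟨t, i, D.nextArm i d, some i, false⟩ :: ·) := by
  have step_eq : step D A (E.prefAt t) t (State.detecting i d obs) =
      (duelOutcome (E.prefAt t i (D.nextArm i d))).map fun x =>
        if D.triggers (D.observe i d obs x (D.nextArm i d)) then
          (⟨t, i, D.nextArm i d, some i, true⟩, State.init)
        else (⟨t, i, D.nextArm i d, some i, false⟩,
          State.detecting i (d + 1) (D.observe i d obs x)) := rfl
  rw [detectFrom_eq_step_bind D A E ht, step_eq, PMF.bind_map]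
  refine congrArg (PMF.bind _) (funext fun x => ?_)
  rw [Function.comp_apply]
  split_ifs <;> rfl

theorem detect_eq_run_bind {t n : ℕ} (hn : n ≤ D.Ttil) (ht : t + n ≤ E.T + 1) :
    detect D A E t = (A.run E.prefAt t n).bind fun h =>
      (detectFrom D A E (t + n) (State.running h)).map (runningRounds t h ++ ·) := by
  induction n with
  | zero =>
    rw [Algorithm.run, PMF.pure_bind]
    exact (PMF.map_id _).symm
  | succ n ih =>
    rw [ih (by omega) (by omega), Algorithm.run, PMF.bind_bind]
    refine bind_congr_of_mem_support fun h hh => ?_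
    have h_length := length_of_mem_support_run A E.prefAt t n h hh
    rw [detectFrom_running D A E (by omega) (by omega), PMF.map_bind, PMF.bind_map]
    refine congrArg (PMF.bind _) (funext fun d => ?_)
    simp only [PMF.map_comp, Function.comp_def, runningRounds, List.append_assoc, h_length,
      List.singleton_append, add_assoc]

theorem detect_eq_bind_suspect {t : ℕ} (ht : t + D.Ttil ≤ E.T) :
    detect D A E t = (A.run E.prefAt t D.Ttil).bind fun h => (A.suspect h).bind fun i =>
      (detectFrom D A E (t + D.Ttil) (State.detecting i 0 fun _ => [])).map
        (runningRounds t h ++ ·) := by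
  rw [detect_eq_run_bind D A E le_rfl (by omega)]
  refine bind_congr_of_mem_support fun h hh => ?_
  rw [detectFrom_running_of_length_eq D A E ht (length_of_mem_support_run A _ _ _ h hh),
    PMF.map_bind]

theorem time_of_mem_support_step {P : Fin K → Fin K → unitInterval} {t : ℕ} {s : State K}
    {r : Round K × State K} (hr : r ∈ (step D A P t s).support) : r.1.time = t := by
  have detecting_case {i d obs} (hr : r ∈ (detectStep D P t i d obs).support) : r.1.time = t := by
    rw [detectStep, PMF.mem_support_map_iff] at hr
    obtain ⟨x, -, rfl⟩ := hr
    dsimp only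
    split_ifs <;> rfl
  rcases s with h | ⟨i, d, obs⟩
  · rw [step] at hr
    split_ifs at hr
    · rw [PMF.mem_support_map_iff] at hr
      obtain ⟨x, -, rfl⟩ := hr
      rfl
    · rw [PMF.mem_support_bind_iff] at hr
      obtain ⟨i, -, hi⟩ := hr
      exact detecting_case hi
  · exact detecting_case hr

theorem le_alarmTime_of_mem_support_runFrom {n t : ℕ} {s : State K} {ω : List (Round K)}
    (hω : ω ∈ (runFrom D A E n t s).support) : (t : ℕ∞) ≤ alarmTime ω := by
  induction n generalizing t s ω with
  | zero =>
    rw [runFrom, PMF.mem_support_pure_iff] at hω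
    simp [hω, alarmTime]
  | succ n ih =>
    rw [runFrom, PMF.mem_support_bind_iff] at hω
    obtain ⟨r, hr, hω⟩ := hω
    rw [PMF.mem_support_map_iff] at hω
    obtain ⟨ω, hω, rfl⟩ := hω
    rw [alarmTime]
    split_ifs
    · rw [time_of_mem_support_step D A hr]
    · exact le_trans (by simp) (ih hω)

theorem firstSuspect_of_mem_support {t : ℕ} (ht : t ≤ E.T) {i : Fin K} {d : ℕ}
    {obs : Fin K → List Bool} {ω : List (Round K)}
    (hω : ω ∈ (detectFrom D A E t (State.detecting i d obs)).support) :
    firstSuspect ω = some i := by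
  rw [detectFrom_detecting D A E ht, PMF.mem_support_bind_iff] at hω
  obtain ⟨x, -, hω⟩ := hω
  split_ifs at hω
  all_goals
    rw [PMF.mem_support_map_iff] at hω
    obtain ⟨ω, -, rfl⟩ := hω
    rfl

theorem toOuterMeasure_le_alarmTime_detecting {k t : ℕ} (ht : t + k ≤ E.T + 1) (i : Fin K) (d : ℕ)
    (obs : Fin K → List Bool) :
    (detectFrom D A E t (State.detecting i d obs)).toOuterMeasure
        {ω | ((t + k : ℕ) : ℕ∞) ≤ alarmTime ω} =
      ENNReal.ofReal (noAlarmProb D E i k t d obs) := by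
  induction k generalizing t d obs with
  | zero =>
    rw [noAlarmProb, noAlarmMean, ENNReal.ofReal_one, PMF.toOuterMeasure_apply_eq_one_iff]
    exact fun _ hω => le_alarmTime_of_mem_support_runFrom D A E hω
  | succ k ih =>
    classical
    have alarm_now : {_ω : List (Round K) | ((t + (k + 1) : ℕ) : ℕ∞) ≤ t} = ∅ :=
      Set.eq_empty_of_forall_notMem fun _ h =>
        (Nat.cast_le (α := ℕ∞).1 h).not_gt (by omega)
    rw [detectFrom_detecting D A E (by omega), PMF.toOuterMeasure_bind_apply, noAlarmProb,
      noAlarmMean, ← lexpect_duelOutcome_ofReal]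
    · refine tsum_congr fun x => congrArg (_ * ·) ?_
      beta_reduce
      split_ifs
      · rw [PMF.toOuterMeasure_map_apply, ENNReal.ofReal_zero]
        exact (congrArg _ alarm_now).trans (MeasureTheory.measure_empty (μ := PMF.toOuterMeasure _))
      · rw [PMF.toOuterMeasure_map_apply, ← noAlarmProb, ← ih (t := t + 1) (by omega),
          add_right_comm t 1 k]
        rfl
    · intro x
      split_ifs
      exacts [le_rfl, noAlarmProb_nonneg D E i _ _ _ _]

end Law

section LawInSegment

variable (D : Params K) (A : Algorithm K) (E : Problem K) {m t : ℕ}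

theorem prefAt_eq (hm : m ≤ E.M) (h1 : E.ν (m - 1) ≤ t) (h2 : t < E.ν m) :
    E.prefAt t = E.pref m :=
  congrArg E.pref (E.seg_eq hm h1 h2)

theorem run_prefAt_eq {n : ℕ} (hm : m ≤ E.M) (h1 : E.ν (m - 1) ≤ t) (h2 : t + n ≤ E.ν m) :
    A.run E.prefAt t n = A.run (fun _ => E.pref m) 1 n :=
  run_eq_of_stationary A fun _ hk => prefAt_eq E hm (by omega) (by omega)

theorem identProb_nonneg (P : Fin K → Fin K → unitInterval) (n : ℕ) (i : Fin K) :
    0 ≤ A.identProb P n i :=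
  ENNReal.toReal_nonneg

theorem identProb_le_one (P : Fin K → Fin K → unitInterval) (n : ℕ) (i : Fin K) :
    A.identProb P n i ≤ 1 :=
  ENNReal.toReal_mono ENNReal.one_ne_top (PMF.coe_le_one _ _)

theorem toOuterMeasure_correctEvent_inter_detecting (ht : t ≤ E.T) {i : Fin K} {d : ℕ}
    {obs : Fin K → List Bool} {h : List (Duel K)} {t₀ : ℕ} {S : Set (List (Round K))}
    (hS : (runningRounds t₀ h ++ ·) ⁻¹' S = S) :
    ((detectFrom D A E t (State.detecting i d obs)).map
        (runningRounds t₀ h ++ ·)).toOuterMeasure (correctEvent E m ∩ S) =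
      if i = E.cw m then
        (detectFrom D A E t (State.detecting (E.cw m) d obs)).toOuterMeasure S else 0 := by
  have correct_iff {ω : List (Round K)}
      (hω : ω ∈ (detectFrom D A E t (State.detecting i d obs)).support) :
      runningRounds t₀ h ++ ω ∈ correctEvent E m ↔ i = E.cw m := by
    rw [correctEvent, Set.mem_ofPred_eq, firstSuspect_runningRounds_append,
      firstSuspect_of_mem_support D A E ht hω, Option.some_inj]
  rw [PMF.toOuterMeasure_map_apply, Set.preimage_inter, hS]
  split_ifs with hi
  · subst hi
    refine PMF.toOuterMeasure_apply_eq_of_inter_support_eq _ (Set.ext fun ω => ?_)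
    exact ⟨fun hω => ⟨hω.1.2, hω.2⟩, fun hω => ⟨⟨(correct_iff hω.2).2 rfl, hω.1⟩, hω.2⟩⟩
  · rw [PMF.toOuterMeasure_apply_eq_zero_iff, Set.disjoint_left]
    exact fun ω hω h_correct => hi ((correct_iff hω).1 h_correct.1)

theorem prob_correctEvent_inter (hm : m ≤ E.M) (h1 : E.ν (m - 1) ≤ t)
    (h2 : t + D.Ttil < E.ν m) {S : Set (List (Round K))}
    (hS : ∀ h, (runningRounds t h ++ ·) ⁻¹' S = S) :
    prob (detect D A E t) (correctEvent E m ∩ S) =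
      A.identProb (E.pref m) D.Ttil (E.cw m) *
        prob (detectFrom D A E (t + D.Ttil)
          (State.detecting (E.cw m) 0 fun _ => [])) S := by
  have le_T : t + D.Ttil ≤ E.T := Nat.le_of_lt_succ (h2.trans_le (E.ν_le_T_add_one hm))
  rw [prob, prob, Algorithm.identProb, ← ENNReal.toReal_mul, detect_eq_bind_suspect D A E le_T,
    run_prefAt_eq A E hm h1 h2.le, PMF.toOuterMeasure_bind_apply, PMF.bind_apply,
    ← ENNReal.tsum_mul_right]
  simp only [PMF.toOuterMeasure_bind_apply,
    toOuterMeasure_correctEvent_inter_detecting D A E le_T (hS _), mul_ite, mul_zero, tsum_ite_eq,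
    mul_assoc]

theorem prob_correctEvent_inter_le_alarmTime {s : ℕ} (hm : m ≤ E.M) (h1 : E.ν (m - 1) ≤ t)
    (h2 : t + D.Ttil < E.ν m) (hts : t + D.Ttil ≤ s) (hs : s ≤ E.T + 1) :
    prob (detect D A E t) (correctEvent E m ∩ {ω | (s : ℕ∞) ≤ alarmTime ω}) =
      A.identProb (E.pref m) D.Ttil (E.cw m) * quietProb D E (E.cw m) (t + D.Ttil) s := by
  rw [prob_correctEvent_inter D A E hm h1 h2 fun h => by
    simp only [Set.preimage_ofPred_eq, alarmTime_runningRounds_append]]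
  obtain ⟨k, rfl⟩ := Nat.exists_eq_add_of_le hts
  rw [prob, toOuterMeasure_le_alarmTime_detecting D A E hs, quietProb, Nat.add_sub_cancel_left,
    ENNReal.toReal_ofReal (noAlarmProb_nonneg D E _ _ _ _ _)]

theorem prob_correctEvent (hm : m ≤ E.M) (h1 : E.ν (m - 1) ≤ t) (h2 : t + D.Ttil < E.ν m) :
    prob (detect D A E t) (correctEvent E m) = A.identProb (E.pref m) D.Ttil (E.cw m) := by
  have h := prob_correctEvent_inter D A E hm h1 h2 fun _ => Set.preimage_univ
  rwa [Set.inter_univ, prob, prob, (PMF.toOuterMeasure_apply_eq_one_iff _ _).2 (Set.subset_univ _),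
    ENNReal.toReal_one, mul_one] at h

theorem identProb_mul_one_sub_quietProb_le (hm : m ≤ E.M) (h1 : E.ν (m - 1) ≤ t)
    (h2 : t + D.Ttil < E.ν m) {p : ℝ}
    (hp : condProb (detect D A E t) {ω | alarmTime ω < (E.ν m : ℕ∞)} (correctEvent E m) ≤ p) :
    A.identProb (E.pref m) D.Ttil (E.cw m) *
        (1 - quietProb D E (E.cw m) (t + D.Ttil) (E.ν m)) ≤
      p * A.identProb (E.pref m) D.Ttil (E.cw m) := by
  have split := prob_inter_add_prob_diff (detect D A E t) (correctEvent E m)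
    {ω | (E.ν m : ℕ∞) ≤ alarmTime ω}
  have diff_eq : correctEvent E m \ {ω | (E.ν m : ℕ∞) ≤ alarmTime ω} =
      correctEvent E m ∩ {ω | alarmTime ω < (E.ν m : ℕ∞)} :=
    Set.ext fun ω => and_congr_right' (not_le (a := (E.ν m : ℕ∞)) (b := alarmTime ω))
  have false_alarm := prob_inter_le_of_condProb_le hp
  rw [prob_correctEvent_inter_le_alarmTime D A E hm h1 h2 h2.le (E.ν_le_T_add_one hm),
    diff_eq] at split
  rw [prob_correctEvent D A E hm h1 h2] at split false_alarm
  linarith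

theorem identProb_mul_quietProb_le {s : ℕ} (hm : m ≤ E.M) (h1 : E.ν (m - 1) ≤ t)
    (h2 : t + D.Ttil < E.ν m) (hs : E.ν m ≤ s) (hsT : s ≤ E.T + 1) {q : ℝ}
    (hq : condProb (detect D A E t) {ω | (s : ℕ∞) ≤ alarmTime ω}
      ({ω | (E.ν m : ℕ∞) ≤ alarmTime ω} ∩ correctEvent E m) ≤ q) :
    A.identProb (E.pref m) D.Ttil (E.cw m) * quietProb D E (E.cw m) (t + D.Ttil) s ≤
      q * (A.identProb (E.pref m) D.Ttil (E.cw m) *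
        quietProb D E (E.cw m) (t + D.Ttil) (E.ν m)) := by
  have late_alarm := prob_inter_le_of_condProb_le hq
  have inter_eq : {ω | (E.ν m : ℕ∞) ≤ alarmTime ω} ∩ correctEvent E m ∩
      {ω | (s : ℕ∞) ≤ alarmTime ω} = correctEvent E m ∩ {ω | (s : ℕ∞) ≤ alarmTime ω} :=
    Set.ext fun ω => ⟨fun h => ⟨h.1.2, h.2⟩,
      fun h => ⟨⟨((Nat.cast_le.2 hs).trans h.2 : (E.ν m : ℕ∞) ≤ alarmTime ω), h.1⟩, h.2⟩⟩
  rwa [inter_eq, Set.inter_comm {ω | (E.ν m : ℕ∞) ≤ alarmTime ω},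
    prob_correctEvent_inter_le_alarmTime D A E hm h1 h2 (by omega) hsT,
    prob_correctEvent_inter_le_alarmTime D A E hm h1 h2 h2.le (E.ν_le_T_add_one hm)] at late_alarm

end LawInSegment

/-! ## Regret bounds -/

theorem totalRegret_append (E : Problem K) (ω ω' : List (Round K)) :
    totalRegret E (ω ++ ω') = totalRegret E ω + totalRegret E ω' := by
  simp only [totalRegret, List.map_append, List.sum_append]

theorem totalRegret_runningRounds (E : Problem K) (t : ℕ) (h : List (Duel K)) :
    totalRegret E (runningRounds t h) = Algorithm.histRegret E t h := by
  induction h with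
  | nil => rfl
  | cons d h ih =>
    rw [runningRounds, totalRegret_append, ih, Algorithm.histRegret, add_comm]
    simp [totalRegret]

theorem histRegret_congr (E : Problem K) {t t' : ℕ} {h : List (Duel K)}
    (h_seg : ∀ k < h.length, E.seg (t + k) = E.seg (t' + k)) :
    Algorithm.histRegret E t h = Algorithm.histRegret E t' h := by
  induction h with
  | nil => rfl
  | cons d h ih =>
    simp only [List.length_cons] at h_seg
    rw [Algorithm.histRegret, Algorithm.histRegret, ih fun k hk => h_seg k (by omega),
      Problem.weakRegret, h_seg _ (Nat.lt_succ_self _), Problem.weakRegret]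

theorem histRegret_nonneg (E : Problem K) {t : ℕ} (ht : 1 ≤ t) (h : List (Duel K)) :
    0 ≤ Algorithm.histRegret E t h := by
  induction h with
  | nil => exact le_rfl
  | cons d h ih => exact add_nonneg (E.weakRegret_nonneg (by omega) _ _) ih

theorem histRegret_le_length (E : Problem K) (t : ℕ) (h : List (Duel K)) :
    Algorithm.histRegret E t h ≤ h.length := by
  induction h with
  | nil => exact Nat.cast_zero.ge
  | cons d h ih =>
    rw [List.length_cons, Nat.cast_succ, add_comm]
    exact add_le_add (E.weakRegret_le_one _ _ _) ih

theorem ofReal_expRegret (A : Algorithm K) (E : Problem K) {t : ℕ} (ht : 1 ≤ t) (n : ℕ) :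
    ENNReal.ofReal (A.expRegret E t n) =
      lexpect (A.run E.prefAt t n) fun h => ENNReal.ofReal (Algorithm.histRegret E t h) := by
  refine ofReal_expect (fun h _ => histRegret_nonneg E ht h)
    (ne_top_of_le_ne_top (ENNReal.natCast_ne_top n) ?_)
  calc (lexpect (A.run E.prefAt t n) fun h => ENNReal.ofReal (Algorithm.histRegret E t h))
      ≤ lexpect (A.run E.prefAt t n) fun _ => (n : ℝ≥0∞) := lexpect_mono fun h hh => by
        rw [← ENNReal.ofReal_natCast, ← length_of_mem_support_run A E.prefAt t n h hh]
        exact ENNReal.ofReal_le_ofReal (histRegret_le_length E t h)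
    _ = n := lexpect_const _ _

theorem expRegret_nonneg (A : Algorithm K) (E : Problem K) {t : ℕ} (ht : 1 ≤ t) (n : ℕ) :
    0 ≤ A.expRegret E t n :=
  MeasureTheory.integral_nonneg fun h => histRegret_nonneg E ht h

theorem expRegret_eq_of_segment (A : Algorithm K) (E : Problem K) {m t n : ℕ} (hm : m ≤ E.M)
    (h1 : E.ν (m - 1) ≤ t) (h2 : t + n ≤ E.ν m) :
    A.expRegret E t n = A.expRegret E (E.ν (m - 1)) n := by
  have one_le : 1 ≤ E.ν (m - 1) := E.one_le_ν (by omega)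
  rw [← ENNReal.ofReal_eq_ofReal_iff (expRegret_nonneg A E (one_le.trans h1) n)
    (expRegret_nonneg A E one_le n), ofReal_expRegret A E (one_le.trans h1),
    ofReal_expRegret A E one_le, run_prefAt_eq A E hm h1 h2,
    run_prefAt_eq A E hm le_rfl (by omega)]
  refine lexpect_congr fun h hh => congrArg ENNReal.ofReal (histRegret_congr E fun k hk => ?_)
  rw [length_of_mem_support_run A _ _ _ h hh] at hk
  rw [E.seg_eq hm (by omega) (by omega), E.seg_eq hm (by omega) (by omega)]

/-- The expected regret of DETECT on the time steps `t, …, T` when it is in the state `s` at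
time `t`. -/
def regretFrom (D : Params K) (A : Algorithm K) (E : Problem K) (t : ℕ) (s : State K) : ℝ≥0∞ :=
  lexpect (detectFrom D A E t s) fun ω => ENNReal.ofReal (totalRegret E ω)

section Regret

variable (D : Params K) (A : Algorithm K) (E : Problem K)

theorem lexpect_totalRegret_append_le (μ : PMF (List (Round K))) (ω : List (Round K)) :
    (lexpect (μ.map (ω ++ ·)) fun ω' => ENNReal.ofReal (totalRegret E ω')) ≤
      ENNReal.ofReal (totalRegret E ω) +
        lexpect μ fun ω' => ENNReal.ofReal (totalRegret E ω') := by
  calc (lexpect (μ.map (ω ++ ·)) fun ω' => ENNReal.ofReal (totalRegret E ω'))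
      = lexpect μ fun ω' => ENNReal.ofReal (totalRegret E ω + totalRegret E ω') := by
        simp only [lexpect_map, totalRegret_append]
    _ ≤ lexpect μ fun ω' => ENNReal.ofReal (totalRegret E ω) + ENNReal.ofReal (totalRegret E ω') :=
        lexpect_mono fun _ _ => ENNReal.ofReal_add_le
    _ = _ := by rw [lexpect_add, lexpect_const]

theorem lexpect_totalRegret_cons_le (μ : PMF (List (Round K))) (r : Round K) :
    (lexpect (μ.map (r :: ·)) fun ω => ENNReal.ofReal (totalRegret E ω)) ≤
      ENNReal.ofReal (E.weakRegret r.time r.fst r.snd) +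
        lexpect μ fun ω => ENNReal.ofReal (totalRegret E ω) := by
  simpa [totalRegret] using lexpect_totalRegret_append_le E μ [r]

theorem regretFrom_le_steps (t : ℕ) (s : State K) :
    regretFrom D A E t s ≤ (E.T + 1 - t : ℕ) := by
  rw [regretFrom, detectFrom]
  induction E.T + 1 - t generalizing t s with
  | zero => simp [runFrom, totalRegret]
  | succ n ih =>
    rw [runFrom, lexpect_bind, ← lexpect_const (step D A (E.prefAt t) t s) ((n + 1 : ℕ) : ℝ≥0∞)]
    refine lexpect_mono fun r _ => (lexpect_totalRegret_cons_le E _ _).trans ?_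
    rw [Nat.cast_succ, add_comm]
    refine add_le_add (ih _ _) ?_
    rw [← ENNReal.ofReal_one]
    exact ENNReal.ofReal_le_ofReal (E.weakRegret_le_one _ _ _)

theorem regretFrom_le_T {t : ℕ} (ht : 1 ≤ t) (s : State K) :
    regretFrom D A E t s ≤ ENNReal.ofReal E.T := by
  rw [ENNReal.ofReal_natCast]
  exact (regretFrom_le_steps D A E t s).trans (Nat.cast_le.2 (by omega))

theorem regretFrom_init_le_add_lexpect {t : ℕ} (ht : 1 ≤ t) (h : t + D.Ttil ≤ E.T) :
    regretFrom D A E t State.init ≤ ENNReal.ofReal (A.expRegret E t D.Ttil) +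
      lexpect ((A.run E.prefAt t D.Ttil).bind A.suspect) fun i =>
        regretFrom D A E (t + D.Ttil) (State.detecting i 0 fun _ => []) := by
  change (lexpect (detect D A E t) fun ω => ENNReal.ofReal (totalRegret E ω)) ≤ _
  rw [detect_eq_bind_suspect D A E h, ofReal_expRegret A E ht, lexpect_bind, lexpect_bind,
    ← lexpect_add]
  refine lexpect_mono fun h _ => ?_
  rw [lexpect_bind, ← totalRegret_runningRounds, ← lexpect_const (A.suspect h)
    (ENNReal.ofReal (totalRegret E (runningRounds t h))), ← lexpect_add]
  exact lexpect_mono fun i _ => lexpect_totalRegret_append_le E _ _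

open Classical in
theorem regretFrom_detecting_le_ofReal_duelMean {t : ℕ} (ht : t ≤ E.T) {i : Fin K} {d : ℕ}
    {obs : Fin K → List Bool} {r a : ℝ} {φ : Bool → ℝ} (hr : 0 ≤ r) (ha : 0 ≤ a)
    (hφ : ∀ x, 0 ≤ φ x) (regret_le : E.weakRegret t i (D.nextArm i d) ≤ r)
    (restart_le : regretFrom D A E (t + 1) State.init ≤ ENNReal.ofReal a)
    (continue_le : ∀ x, regretFrom D A E (t + 1)
      (State.detecting i (d + 1) (D.observe i d obs x)) ≤ ENNReal.ofReal (φ x)) :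
    regretFrom D A E t (State.detecting i d obs) ≤
      ENNReal.ofReal (duelMean (E.prefAt t i (D.nextArm i d)) fun x =>
        r + if D.triggers (D.observe i d obs x (D.nextArm i d)) then a else φ x) := by
  rw [regretFrom, detectFrom_detecting D A E ht, lexpect_bind, ← lexpect_duelOutcome_ofReal]
  · refine lexpect_mono fun x _ => ?_
    split_ifs
    · rw [ENNReal.ofReal_add hr ha]
      exact (lexpect_totalRegret_cons_le E _ _).trans
        (add_le_add (ENNReal.ofReal_le_ofReal regret_le) restart_le)
    · rw [ENNReal.ofReal_add hr (hφ x)]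
      exact (lexpect_totalRegret_cons_le E _ _).trans
        (add_le_add (ENNReal.ofReal_le_ofReal regret_le) (continue_le x))
  · intro x
    split_ifs
    exacts [add_nonneg hr ha, add_nonneg hr (hφ x)]

theorem regretFrom_detecting_le {n t : ℕ} (hn : t + n ≤ E.T + 1) {i : Fin K} (d : ℕ)
    (obs : Fin K → List Bool) {r a : ℝ} {φ : ℕ → (Fin K → List Bool) → ℝ} (hr : 0 ≤ r)
    (ha : 0 ≤ a) (hφ : ∀ d obs, 0 ≤ φ d obs)
    (regret_le : ∀ u, t ≤ u → u < t + n → ∀ j, E.weakRegret u i j ≤ r)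
    (restart_le : ∀ u, t < u → u ≤ t + n → regretFrom D A E u State.init ≤ ENNReal.ofReal a)
    (continue_le : ∀ d obs,
      regretFrom D A E (t + n) (State.detecting i d obs) ≤ ENNReal.ofReal (φ d obs)) :
    regretFrom D A E t (State.detecting i d obs) ≤
      ENNReal.ofReal (n * r + a * (1 - noAlarmProb D E i n t d obs) +
        noAlarmMean D E i φ n t d obs) := by
  classical
  induction n generalizing t d obs with
  | zero => simpa [noAlarmProb, noAlarmMean] using continue_le d obs
  | succ n ih =>
    have mean_nonneg (obs) : 0 ≤ noAlarmMean D E i φ n (t + 1) (d + 1) obs :=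
      noAlarmMean_nonneg D E i hφ ..
    have duel_le (x : Bool) : (r + if D.triggers (D.observe i d obs x (D.nextArm i d)) then a
          else n * r + a * (1 - noAlarmProb D E i n (t + 1) (d + 1) (D.observe i d obs x)) +
            noAlarmMean D E i φ n (t + 1) (d + 1) (D.observe i d obs x)) ≤
        (n + 1) * r + a * (1 - if D.triggers (D.observe i d obs x (D.nextArm i d)) then 0
          else noAlarmProb D E i n (t + 1) (d + 1) (D.observe i d obs x)) +
            if D.triggers (D.observe i d obs x (D.nextArm i d)) then 0
            else noAlarmMean D E i φ n (t + 1) (d + 1) (D.observe i d obs x) := by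
      have := mul_nonneg n.cast_nonneg hr
      split_ifs <;> linarith
    refine (regretFrom_detecting_le_ofReal_duelMean D A E (by omega) hr ha
      (fun x => add_nonneg (add_nonneg (mul_nonneg n.cast_nonneg hr)
        (mul_nonneg ha (sub_nonneg.2 (noAlarmProb_le_one D E i _ _ _ _)))) (mean_nonneg _))
      (regret_le t le_rfl (by omega) _) (restart_le (t + 1) (by omega) (by omega))
      fun x => ih (by omega) (d + 1) (D.observe i d obs x)
        (fun u hu hu' => regret_le u (by omega) (by omega))
        (fun u hu hu' => restart_le u (by omega) (by omega))
        fun d obs => ?_).trans (ENNReal.ofReal_le_ofReal ?_)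
    · rw [add_right_comm, add_assoc]
      exact continue_le d obs
    · refine (duelMean_mono _ duel_le).trans_eq ?_
      simp only [noAlarmProb, noAlarmMean, duelMean, Nat.cast_succ]
      ring

theorem regretFrom_detecting_le_of_restart {n s : ℕ} (hs : 1 ≤ s) (hn : s + n ≤ E.T + 1)
    {S : ℝ} (hS : 0 ≤ S)
    (restart_le : ∀ u, s < u → u ≤ s + n → regretFrom D A E u State.init ≤ ENNReal.ofReal S)
    (i : Fin K) (d : ℕ) (obs : Fin K → List Bool) :
    regretFrom D A E s (State.detecting i d obs) ≤
      ENNReal.ofReal (n + S + E.T * noAlarmProb D E i n s d obs) := by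
  refine (regretFrom_detecting_le D A E hn d obs zero_le_one hS (fun _ _ => E.T.cast_nonneg)
    (fun u _ _ j => E.weakRegret_le_one u i j) restart_le
    fun d obs => regretFrom_le_T D A E (by omega) _).trans (ENNReal.ofReal_le_ofReal ?_)
  rw [noAlarmMean_const]
  linarith [mul_nonneg hS (noAlarmProb_nonneg D E i n s d obs)]

theorem regretFrom_detecting_le_of_change {t s n : ℕ} (ht : 1 ≤ t) (hts : t ≤ s)
    (hn : s + n ≤ E.T + 1) {i : Fin K}
    (no_regret : ∀ u, t ≤ u → u < s → ∀ j, E.weakRegret u i j = 0) {S : ℝ} (hS : 0 ≤ S)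
    (restart_le : ∀ u, s < u → u ≤ s + n → regretFrom D A E u State.init ≤ ENNReal.ofReal S) :
    regretFrom D A E t (State.detecting i 0 fun _ => []) ≤ ENNReal.ofReal
      (n + S + E.T * (1 - (quietProb D E i t s - quietProb D E i t (s + n)))) := by
  obtain ⟨k, rfl⟩ := Nat.exists_eq_add_of_le hts
  have h := regretFrom_detecting_le D A E (n := k) (by omega) 0 (fun _ => []) le_rfl
    E.T.cast_nonneg
    (fun d obs => add_nonneg (add_nonneg n.cast_nonneg hS)
      (mul_nonneg E.T.cast_nonneg (noAlarmProb_nonneg D E i n (t + k) d obs)))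
    (fun u hu hu' j => (no_regret u hu hu' j).le)
    (fun u hu _ => regretFrom_le_T D A E (by omega) State.init)
    (regretFrom_detecting_le_of_restart D A E (by omega) hn hS restart_le i)
  refine h.trans (ENNReal.ofReal_le_ofReal ?_)
  rw [noAlarmMean_const_add_const_mul, quietProb, quietProb, add_assoc t, Nat.add_sub_cancel_left,
    Nat.add_sub_cancel_left, noAlarmProb_add_steps]
  linarith [mul_le_mul_of_nonneg_left (noAlarmProb_le_one D E i k t 0 fun _ => [])
    (add_nonneg n.cast_nonneg hS)]

theorem regretFrom_detecting_le_of_no_regret {t : ℕ} (ht : 1 ≤ t) (htT : t ≤ E.T + 1)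
    {i : Fin K} (no_regret : ∀ u, t ≤ u → u < E.T + 1 → ∀ j, E.weakRegret u i j = 0) :
    regretFrom D A E t (State.detecting i 0 fun _ => []) ≤
      ENNReal.ofReal (E.T * (1 - quietProb D E i t (E.T + 1))) := by
  obtain ⟨k, hk⟩ := Nat.exists_eq_add_of_le htT
  have h := regretFrom_detecting_le D A E hk.ge (i := i) 0 (fun _ => []) le_rfl E.T.cast_nonneg
    (φ := fun _ _ => 0) (fun _ _ => le_rfl)
    (fun u hu hu' j => (no_regret u hu (by omega) j).le)
    (fun u hu _ => regretFrom_le_T D A E (by omega) State.init)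
    fun d obs => (regretFrom_le_steps D A E _ _).trans (by simp [hk])
  simpa [noAlarmMean_const, quietProb, hk] using h

theorem regretFrom_init_le {m t : ℕ} (hm : m ≤ E.M) (h1 : E.ν (m - 1) ≤ t)
    (h2 : t + D.Ttil < E.ν m) {y : ℝ} (hy : 0 ≤ y)
    (h : regretFrom D A E (t + D.Ttil) (State.detecting (E.cw m) 0 fun _ => []) ≤
      ENNReal.ofReal y) :
    regretFrom D A E t State.init ≤
      ENNReal.ofReal (A.expRegret E (E.ν (m - 1)) D.Ttil +
        (A.identProb (E.pref m) D.Ttil (E.cw m) * y +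
          (1 - A.identProb (E.pref m) D.Ttil (E.cw m)) * E.T)) := by
  have one_le : 1 ≤ t := (E.one_le_ν (by omega)).trans h1
  rw [ENNReal.ofReal_add (expRegret_nonneg A E (E.one_le_ν (by omega)) _)
    (add_nonneg (mul_nonneg (identProb_nonneg A _ _ _) hy)
      (mul_nonneg (sub_nonneg.2 (identProb_le_one A _ _ _)) E.T.cast_nonneg)),
    ← expRegret_eq_of_segment A E hm h1 h2.le]
  refine (regretFrom_init_le_add_lexpect D A E one_le
    (Nat.le_of_lt_succ (h2.trans_le (E.ν_le_T_add_one hm)))).trans (add_le_add le_rfl ?_)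
  rw [run_prefAt_eq A E hm h1 h2.le]
  exact lexpect_le_of_forall_ne_le _ _ hy E.T.cast_nonneg h
    fun i _ => regretFrom_le_T D A E (by omega) _

end Regret

/-- The probability that DETECT, initialized at the beginning of segment `m`, raises an alarm before
the end of this segment, given that its first suspected Condorcet winner is the right one (`0` if
this has probability `0`). -/
def falseAlarmProb (D : Params K) (A : Algorithm K) (E : Problem K) (m : ℕ) : ℝ :=
  condProb (detect D A E (E.ν (m - 1))) {ω | alarmTime ω < (E.ν m : ℕ∞)} (correctEvent E m)

/-- The probability that DETECT, initialized at the beginning of segment `m`, raises no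
alarm in the first `L / 2` steps after the end of this segment, given that it has raised none before
and that its first suspected Condorcet winner is the right one (`0` if this has probability `0`). -/
def lateAlarmProb (D : Params K) (A : Algorithm K) (E : Problem K) (m : ℕ) : ℝ :=
  condProb (detect D A E (E.ν (m - 1))) {ω | ((E.ν m + D.L / 2 : ℕ) : ℕ∞) ≤ alarmTime ω}
    ({ω | (E.ν m : ℕ∞) ≤ alarmTime ω} ∩ correctEvent E m)

section Segment

variable (D : Params K) (A : Algorithm K) (E : Problem K) {m t : ℕ} {pT p q : ℝ}

theorem one_sub_identProb_mul_quietProb_le (hm : m ≤ E.M) (h1 : E.ν (m - 1) ≤ t)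
    (h2 : t + D.Ttil < E.ν m) (hpT : pT ≤ A.identProb (E.pref m) D.Ttil (E.cw m)) (hp1 : p ≤ 1)
    (hp : falseAlarmProb D A E m ≤ p) :
    1 - A.identProb (E.pref m) D.Ttil (E.cw m) *
        quietProb D E (E.cw m) (t + D.Ttil) (E.ν m) ≤ 1 - pT + p * pT := by
  have false_alarm := identProb_mul_one_sub_quietProb_le D A E hm le_rfl (by omega) hp
  have later_start : quietProb D E (E.cw m) (E.ν (m - 1) + D.Ttil) (E.ν m) ≤
      quietProb D E (E.cw m) (t + D.Ttil) (E.ν m) :=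
    quietProb_le_of_le D (E.cw m) (Nat.add_le_add_right h1 D.Ttil)
      fun u hu hu' => prefAt_eq E hm (by omega) hu'
  have h_pT := mul_le_mul_of_nonneg_left hpT (sub_nonneg.2 hp1)
  linarith [mul_le_mul_of_nonneg_left later_start (identProb_nonneg A (E.pref m) D.Ttil (E.cw m))]

theorem one_sub_add_mul_nonneg (hm : m ≤ E.M) (h : E.ν (m - 1) + D.Ttil < E.ν m)
    (hpT : pT ≤ A.identProb (E.pref m) D.Ttil (E.cw m)) (hp1 : p ≤ 1)
    (hp : falseAlarmProb D A E m ≤ p) : 0 ≤ 1 - pT + p * pT :=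
  (sub_nonneg.2 (mul_le_one₀ (identProb_le_one A _ _ _) (quietProb_nonneg ..)
    (quietProb_le_one ..))).trans
      (one_sub_identProb_mul_quietProb_le D A E hm le_rfl h hpT hp1 hp)

theorem one_sub_identProb_mul_quietProb_sub_le (hK : 2 ≤ K) (hm : m < E.M)
    (h1 : E.ν (m - 1) ≤ t) (h2 : t + D.Ttil + D.L ≤ E.ν m) (h3 : E.ν m + D.L / 2 ≤ E.ν (m + 1))
    (hpT : pT ≤ A.identProb (E.pref m) D.Ttil (E.cw m)) (hp1 : p ≤ 1) (hq0 : 0 ≤ q)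
    (hp : falseAlarmProb D A E m ≤ p) (hq : lateAlarmProb D A E m ≤ q) :
    1 - A.identProb (E.pref m) D.Ttil (E.cw m) *
        (quietProb D E (E.cw m) (t + D.Ttil) (E.ν m) -
          quietProb D E (E.cw m) (t + D.Ttil) (E.ν m + D.L / 2)) ≤ 1 - pT + p * pT + q := by
  have L_half_pos := D.L_half_pos hK
  set c := A.identProb (E.pref m) D.Ttil (E.cw m)
  set U := quietProb D E (E.cw m) (E.ν (m - 1) + D.Ttil) (E.ν m)
  set V := quietProb D E (E.cw m) (E.ν (m - 1) + D.Ttil) (E.ν m + D.L / 2)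
  have no_false_alarm : 1 - c * U ≤ 1 - pT + p * pT :=
    one_sub_identProb_mul_quietProb_le D A E hm.le le_rfl (by omega) hpT hp1 hp
  have late_alarm : c * V ≤ q * (c * U) :=
    identProb_mul_quietProb_le D A E hm.le le_rfl (by omega) (Nat.le_add_right _ _)
      (h3.trans (E.ν_le_T_add_one hm)) hq
  have c_U_le_one : q * (c * U) ≤ q :=
    mul_le_of_le_one_right hq0 (mul_le_one₀ (identProb_le_one A _ _ _)
      (quietProb_nonneg ..) (quietProb_le_one ..))
  have later_start := mul_le_mul_of_nonneg_left
    (quietProb_sub_le_of_le D (E.cw m) hK (Nat.add_le_add_right h1 D.Ttil) h2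
      (fun u hu hu' => prefAt_eq E hm.le (by omega) hu')
      fun u hu hu' => prefAt_eq E (m := m + 1) hm hu (by omega))
    (identProb_nonneg A (E.pref m) D.Ttil (E.cw m))
  linarith

theorem regretFrom_init_le_of_last_segment (h1 : E.ν (E.M - 1) ≤ t)
    (h2 : t + D.Ttil < E.ν E.M)
    (hpT : pT ≤ A.identProb (E.pref E.M) D.Ttil (E.cw E.M)) (hp1 : p ≤ 1)
    (hp : falseAlarmProb D A E E.M ≤ p) :
    regretFrom D A E t State.init ≤ ENNReal.ofReal
      (A.expRegret E (E.ν (E.M - 1)) D.Ttil + (1 - pT + p * pT) * E.T) := by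
  have start_pos : 1 ≤ E.ν (E.M - 1) := E.one_le_ν (Nat.sub_le E.M 1)
  have detection := regretFrom_detecting_le_of_no_regret D A E (t := t + D.Ttil) (i := E.cw E.M)
    (by omega) (E.ν_last ▸ h2.le) fun u hu hu' =>
      E.weakRegret_cw E.one_le_M le_rfl (E.seg_eq le_rfl (by omega) (E.ν_last ▸ hu'))
  rw [← E.ν_last] at detection
  refine (regretFrom_init_le D A E le_rfl h1 h2 (mul_nonneg E.T.cast_nonneg
    (sub_nonneg.2 (quietProb_le_one ..))) detection).trans (ENNReal.ofReal_le_ofReal ?_)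
  calc _ = A.expRegret E (E.ν (E.M - 1)) D.Ttil +
        (1 - A.identProb (E.pref E.M) D.Ttil (E.cw E.M) *
          quietProb D E (E.cw E.M) (t + D.Ttil) (E.ν E.M)) * E.T := by ring
    _ ≤ _ := by
        gcongr
        exact one_sub_identProb_mul_quietProb_le D A E le_rfl h1 h2 hpT hp1 hp

theorem regretFrom_init_le_of_segment (hK : 2 ≤ K) (hm1 : 1 ≤ m) (hm : m < E.M)
    (h1 : E.ν (m - 1) ≤ t) (h2 : t + D.Ttil + D.L ≤ E.ν m) (h3 : E.ν m + D.L / 2 ≤ E.ν (m + 1))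
    (hpT : pT ≤ A.identProb (E.pref m) D.Ttil (E.cw m)) (hp1 : p ≤ 1) (hq0 : 0 ≤ q)
    (hp : falseAlarmProb D A E m ≤ p) (hq : lateAlarmProb D A E m ≤ q)
    {S : ℝ} (hS : 0 ≤ S)
    (restart_le : ∀ u, E.ν m < u → u ≤ E.ν m + D.L / 2 →
      regretFrom D A E u State.init ≤ ENNReal.ofReal S) :
    regretFrom D A E t State.init ≤ ENNReal.ofReal
      (A.expRegret E (E.ν (m - 1)) D.Ttil + (D.L / 2 : ℕ) +
        (1 - pT + p * pT + q) * E.T + S) := by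
  have L_half_pos := D.L_half_pos hK
  have start_pos : 1 ≤ E.ν (m - 1) := E.one_le_ν (by omega)
  set c := A.identProb (E.pref m) D.Ttil (E.cw m)
  set U := quietProb D E (E.cw m) (t + D.Ttil) (E.ν m)
  set V := quietProb D E (E.cw m) (t + D.Ttil) (E.ν m + D.L / 2)
  have detection := regretFrom_detecting_le_of_change D A E (t := t + D.Ttil) (s := E.ν m)
    (by omega) (by omega) (h3.trans (E.ν_le_T_add_one hm))
    (fun u hu hu' => E.weakRegret_cw hm1 hm.le (E.seg_eq hm.le (by omega) hu')) hS restart_le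
  have U_sub_V_le_one : U - V ≤ 1 :=
    (sub_le_self _ (quietProb_nonneg ..)).trans (quietProb_le_one ..)
  have delay_nonneg : 0 ≤ (D.L / 2 : ℕ) + S := add_nonneg (Nat.cast_nonneg _) hS
  refine (regretFrom_init_le D A E hm.le h1 (by omega) (add_nonneg delay_nonneg
    (mul_nonneg E.T.cast_nonneg (sub_nonneg.2 U_sub_V_le_one))) detection).trans
      (ENNReal.ofReal_le_ofReal ?_)
  calc _ = A.expRegret E (E.ν (m - 1)) D.Ttil +
        (c * ((D.L / 2 : ℕ) + S) + (1 - c * (U - V)) * E.T) := by ring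
    _ ≤ A.expRegret E (E.ν (m - 1)) D.Ttil +
        ((D.L / 2 : ℕ) + S + (1 - pT + p * pT + q) * E.T) := by
        gcongr
        · exact mul_le_of_le_one_left delay_nonneg (identProb_le_one A _ _ _)
        · exact one_sub_identProb_mul_quietProb_sub_le D A E hK hm h1 h2 h3 hpT hp1 hq0 hp hq
    _ = _ := by ring

theorem start_add_le_of_segLen (hm1 : 1 ≤ m) (hm : m ≤ E.M)
    (h : (D.Ttil : ℝ) + 3 / 2 * (D.L : ℝ) ≤ (E.segLen m : ℝ)) :
    E.ν (m - 1) + D.Ttil + D.L / 2 + D.L ≤ E.ν m := by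
  have ν_lt := E.ν_lt (m - 1) (by omega)
  rw [Nat.sub_add_cancel hm1] at ν_lt
  have cast_L : ((D.L / 2 : ℕ) : ℝ) + (D.L / 2 : ℕ) = D.L := by
    exact_mod_cast D.L_half_add_L_half
  rw [Problem.segLen, Nat.cast_sub ν_lt.le] at h
  have : ((E.ν (m - 1) + D.Ttil + D.L / 2 + D.L : ℕ) : ℝ) ≤ E.ν m := by
    push_cast
    linarith
  exact_mod_cast this

/-- The contribution of segment `m` to the regret bound: running phase, detection delay, and a
failure of probability `x`, to which the maximal regret `T` is charged. -/
def segmentCost (x : ℝ) (m : ℕ) : ℝ :=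
  A.expRegret E (E.ν (m - 1)) D.Ttil + (D.L / 2 : ℕ) + x * E.T

theorem segmentCost_nonneg {x : ℝ} (hx : 0 ≤ x) (hm : m ≤ E.M) : 0 ≤ segmentCost D A E x m :=
  add_nonneg (add_nonneg (expRegret_nonneg A E (E.one_le_ν (by omega)) _) (Nat.cast_nonneg _))
    (mul_nonneg hx E.T.cast_nonneg)

theorem sum_segmentCost_nonneg {x : ℝ} (hx : 0 ≤ x) (m : ℕ) :
    0 ≤ ∑ k ∈ Finset.Icc m E.M, segmentCost D A E x k :=
  Finset.sum_nonneg fun _ hk => segmentCost_nonneg D A E hx (Finset.mem_Icc.1 hk).2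

theorem sum_segmentCost (x : ℝ) :
    ∑ m ∈ Finset.Icc 1 E.M, segmentCost D A E x m =
      (E.M : ℝ) * (D.L : ℝ) / 2 + x * (E.M : ℝ) * (E.T : ℝ) +
        ∑ m ∈ Finset.Icc 1 E.M, A.expRegret E (E.ν (m - 1)) D.Ttil := by
  have cast_L : ((D.L / 2 : ℕ) : ℝ) + (D.L / 2 : ℕ) = D.L := by
    exact_mod_cast D.L_half_add_L_half
  simp only [segmentCost, Finset.sum_add_distrib, Finset.sum_const, Nat.card_Icc, nsmul_eq_mul,
    Nat.add_sub_cancel, ← cast_L]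
  ring

theorem regretFrom_init_le_sum_segmentCost (hK : 2 ≤ K)
    (segment_long : ∀ m, 1 ≤ m → m ≤ E.M → E.ν (m - 1) + D.Ttil + D.L / 2 + D.L ≤ E.ν m)
    (hpT : ∀ m, 1 ≤ m → m ≤ E.M → pT ≤ A.identProb (E.pref m) D.Ttil (E.cw m))
    (hp1 : p ≤ 1) (hq0 : 0 ≤ q)
    (hp : ∀ m, 1 ≤ m → m ≤ E.M → falseAlarmProb D A E m ≤ p)
    (hq : ∀ m, 1 ≤ m → m < E.M → lateAlarmProb D A E m ≤ q)
    (hm1 : 1 ≤ m) (hm : m ≤ E.M) (h1 : E.ν (m - 1) ≤ t) (h2 : t ≤ E.ν (m - 1) + D.L / 2) :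
    regretFrom D A E t State.init ≤
      ENNReal.ofReal (∑ k ∈ Finset.Icc m E.M, segmentCost D A E (1 - pT + p * pT + q) k) := by
  have L_half_pos := D.L_half_pos hK
  induction hm using Nat.decreasingInduction generalizing t with
  | self =>
    have long := segment_long E.M hm1 le_rfl
    refine (regretFrom_init_le_of_last_segment D A E h1 (by omega) (hpT E.M hm1 le_rfl) hp1
      (hp E.M hm1 le_rfl)).trans (ENNReal.ofReal_le_ofReal ?_)
    rw [Finset.Icc_self, Finset.sum_singleton]
    exact add_le_add (le_add_of_nonneg_right (Nat.cast_nonneg _))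
      (mul_le_mul_of_nonneg_right (le_add_of_nonneg_right hq0) E.T.cast_nonneg)
  | of_succ m hm ih =>
    have long := segment_long m hm1 hm.le
    have next_long := segment_long (m + 1) (by omega) hm
    rw [Nat.add_sub_cancel] at next_long ih
    have failure_nonneg : 0 ≤ 1 - pT + p * pT + q :=
      add_nonneg (one_sub_add_mul_nonneg D A E hm.le (by omega) (hpT m hm1 hm.le) hp1
        (hp m hm1 hm.le)) hq0
    rw [← Finset.add_sum_Ioc_eq_sum_Icc hm.le, ← Finset.Icc_add_one_left_eq_Ioc]
    exact regretFrom_init_le_of_segment D A E hK hm1 hm h1 (by omega) (by omega)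
      (hpT m hm1 hm.le) hp1 hq0 (hp m hm1 hm.le) (hq m hm1 hm)
      (sum_segmentCost_nonneg D A E failure_nonneg (m + 1))
      fun u hu hu' => ih (by omega) hu.le hu'

end Segment

end DuelingBandits

end

open DuelingBandits in
theorem theorem4_general {K : ℕ} (hK : 2 ≤ K) (E : Problem K) (A : Algorithm K) (D : Params K)
    (assumption1 : ∀ m, 1 ≤ m → m ≤ E.M →
      (D.Ttil : ℝ) + 3 / 2 * (D.L : ℝ) ≤ (E.segLen m : ℝ))
    (pT : ℝ)
    (hpT : ∀ m, 1 ≤ m → m ≤ E.M → pT ≤ A.identProb (E.pref m) D.Ttil (E.cw m))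
    (p q : ℝ) (hp1 : p ≤ 1) (hq0 : 0 ≤ q)
    (hp : ∀ m, 1 ≤ m → m ≤ E.M →
      condProb (detect D A E (E.ν (m - 1)))
        {ω | alarmTime ω < (E.ν m : ℕ∞)} (correctEvent E m) ≤ p)
    (hq : ∀ m, 1 ≤ m → m < E.M →
      condProb (detect D A E (E.ν (m - 1)))
        {ω | ((E.ν m + D.L / 2 : ℕ) : ℕ∞) ≤ alarmTime ω}
        ({ω | (E.ν m : ℕ∞) ≤ alarmTime ω} ∩ correctEvent E m) ≤ q) :
    expect (detect D A E 1) (totalRegret E) ≤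
      (E.M : ℝ) * (D.L : ℝ) / 2 + (1 - pT + p * pT + q) * (E.M : ℝ) * (E.T : ℝ) +
        ∑ m ∈ Finset.Icc 1 E.M, A.expRegret E (E.ν (m - 1)) D.Ttil := by
  have L_half_pos := D.L_half_pos hK
  have segment_long (m) (h1 : 1 ≤ m) (hm : m ≤ E.M) :=
    start_add_le_of_segLen D E h1 hm (assumption1 m h1 hm)
  have last_long := segment_long E.M E.one_le_M le_rfl
  have failure_nonneg : 0 ≤ 1 - pT + p * pT + q :=
    add_nonneg (one_sub_add_mul_nonneg D A E le_rfl (by omega) (hpT E.M E.one_le_M le_rfl) hp1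
      (hp E.M E.one_le_M le_rfl)) hq0
  rw [← sum_segmentCost]
  exact expect_le_of_lexpect_le (sum_segmentCost_nonneg D A E failure_nonneg 1)
    (regretFrom_init_le_sum_segmentCost D A E hK segment_long hpT hp1 hq0 hp hq le_rfl E.one_le_M
      E.ν_zero.le (by rw [Nat.sub_self, E.ν_zero]; omega))

open DuelingBandits in
theorem theorem4 {K : ℕ} (hK : 2 ≤ K) (E : Problem K) (A : Algorithm K) (D : Params K)
    -- minimal segment length
    (assumption1 : ∀ m, 1 ≤ m → m ≤ E.M →
      (D.Ttil : ℝ) + 3 / 2 * (D.L : ℝ) ≤ (E.segLen m : ℝ))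
    -- minimal change at every changepoint
    (c : ℝ) (hc : 0 < c)
    (assumption2 : ∀ m, 1 ≤ m → m < E.M → 2 * D.b / (D.w : ℝ) + c ≤ E.deltaStar m)
    -- lower bound on the identification probabilities
    (pT : ℝ)
    (hpT : ∀ m, 1 ≤ m → m ≤ E.M → pT ≤ A.identProb (E.pref m) D.Ttil (E.cw m))
    (p q : ℝ) (hp0 : 0 ≤ p) (hp1 : p ≤ 1) (hq0 : 0 ≤ q) (hq1 : q ≤ 1)
    -- false alarms of DETECT initialized at the beginning of segment `m`
    (hp : ∀ m, 1 ≤ m → m ≤ E.M →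
      condProb (detect D A E (E.ν (m - 1)))
        {ω | alarmTime ω < (E.ν m : ℕ∞)} (correctEvent E m) ≤ p)
    -- large delays of DETECT initialized at the beginning of segment `m` (note that `L` is even)
    (hq : ∀ m, 1 ≤ m → m < E.M →
      condProb (detect D A E (E.ν (m - 1)))
        {ω | ((E.ν m + D.L / 2 : ℕ) : ℕ∞) ≤ alarmTime ω}
        ({ω | (E.ν m : ℕ∞) ≤ alarmTime ω} ∩ correctEvent E m) ≤ q) :
    expect (detect D A E 1) (totalRegret E) ≤
      (E.M : ℝ) * (D.L : ℝ) / 2 + (1 - pT + p * pT + q) * (E.M : ℝ) * (E.T : ℝ) +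
        ∑ m ∈ Finset.Icc 1 E.M, A.expRegret E (E.ν (m - 1)) D.Ttil := by
  exact theorem4_general hK E A D assumption1 pT hpT p q hp1 hq0 hp hq
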